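/- Let $p$ be an odd prime, $\xi=e^{2\pi i/p}$, $q=e^{2\pi i\tau}$ for $\tau$ in the upper half plane $\mathfrak H$, and $$\theta(z,\tau)=q^{1/8}(2\sin\pi z)\prod_{l\ge1}(1-q^l)\prod_{l\ge1}(1-q^le^{2\pi iz})(1-q^le^{-2\pi iz}).$$ For $a\in(\mathbb Z/p\mathbb Z)^*$ put $$s_a(\tau)=\frac1{2\pi i}\frac{d}{dz}\ln\theta(z,\tau)\Big|_{z=a/p},\qquad t_a(\tau)=\frac12(2\pi i)^{-2}\Big(\frac{\theta_{zz}(a/p,\tau)}{\theta(a/p,\tau)}-\frac{\theta_{zzz}(0,\tau)}{3\,\theta_z(0,\tau)}\Big)$$ (with $a$ represented by an integer in $\{1,\dots,p-1\}$). For $f:\mathfrak H\to\mathbb C$ and $n\ge 0$ let $$(w_{p,n}f)(\tau)=\Big(\frac{\sqrt p\,\tau}{i}\Big)^{-n}f\Big(-\frac1{p\tau}\Big)$$ be the Fricke involution in weight $n$. Let $\mathbb C[s,t]=\mathbb C[s_1,\dots,s_{p-1},t_1,\dots,t_{p-1}]$ be the polynomial ring in independent variables indexed by $(\mathbb Z/p\mathbb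 Z)^*$, where $s_a$ has weight $1$ and $t_a$ has weight $2$, and let $(-p)^{-1/2}$ denote the principal value $\frac1{i\sqrt p}$. **Proposition (Fricke involution action).** There is a $\mathbb C$-algebra automorphism $w_p$ of $\mathbb C[s,t]$ with $$w_p(s_a)=(-p)^{-1/2}\sum_{k=1}^{p-1}\xi^{ka}s_k,\qquad w_p(t_a)=(-p)^{-1}\sum_{k=1}^{p-1}\xi^{ka}(-s_k^2+2t_k)$$ for all $a\in(\mathbb Z/p\mathbb Z)^*$, and it has the following properties. 1. It is induced by the Fricke involution: as functions on $\mathfrak H$, $$w_{p,1}(s_a(\tau))=(-p)^{-1/2}\sum_{k=1}^{p-1}\xi^{ka}s_k(\tau),\qquad w_{p,2}(t_a(\tau))=(-p)^{-1}\sum_{k=1}^{p-1}\xi^{ka}(-s_k(\tau)^2+2t_k(\tau));$$ more generally, $w_p$ maps weighted homogeneous polynomials $F$ of weight $n$ to weighted homogeneous polynomials of weight $n$, and $w_{p,n}\big(F(s(\tau),t(\tau))\big)=(w_pF)(s(\tau),t(\tau))$. 2. Let $I\subset\mathbb C[s,t]$ be the ideal generated by the quadratic relations $s_as_b+s_bs_c+s_cs_a+t_a+t_b+t_c$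 for $a,b,c\in(\mathbb Z/p\mathbb Z)^*$ with $a+b+c=0$, and by the symmetry relations $s_{-a}+s_a$ and $t_{-a}-t_a$ for $a\in(\mathbb Z/p\mathbb Z)^*$. Then $w_p(I)=I$. Equivalently, the automorphism of $\operatorname{Spec}\mathbb C[s,t]$ given by $w_p$ restricts to an automorphism of the closed subscheme $\operatorname{Spec}\mathbb C[s,t]/I$; this restriction is an involution. -/

import Mathlib

open scoped BigOperators

noncomputable section

namespace FrickeAction

/-- The Jacobi theta function
`θ(z,τ) = q^{1/8} (2 sin πz) ∏_{l ≥ 1} (1 - q^l) ∏_{l ≥ 1} (1 - q^l e^{2πiz}) (1 - q^l e^{-2πiz})`,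
where `q = e^{2πiτ}`. -/
def theta (z τ : ℂ) : ℂ :=
  let q : ℂ := Complex.exp (2 * Real.pi * Complex.I * τ)
  let y : ℂ := Complex.exp (2 * Real.pi * Complex.I * z)
  Complex.exp (2 * Real.pi * Complex.I * τ / 8) * (2 * Complex.sin (Real.pi * z)) *
    (∏' l : ℕ, (1 - q ^ (l + 1))) *
    (∏' l : ℕ, (1 - q ^ (l + 1) * y) * (1 - q ^ (l + 1) * y⁻¹))

/-- The point `a/p` of `ℂ`, with `a` represented by an integer between `0` and `p - 1`. -/
def torsionPoint (p : ℕ) (a : (ZMod p)ˣ) : ℂ := ((a : ZMod p).val : ℂ) / p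

/-- The weight one Eisenstein series `s_a(τ) = (2πi)⁻¹ (d/dz) ln θ(z,τ)` at `z = a/p`. -/
def sForm (p : ℕ) (a : (ZMod p)ˣ) (τ : UpperHalfPlane) : ℂ :=
  (2 * Real.pi * Complex.I)⁻¹ * logDeriv (fun z : ℂ => theta z τ) (torsionPoint p a)

/-- The weight two form
`t_a(τ) = ½ (2πi)⁻² (θ_zz(a/p,τ) / θ(a/p,τ) - θ_zzz(0,τ) / (3 θ_z(0,τ)))`. -/
def tForm (p : ℕ) (a : (ZMod p)ˣ) (τ : UpperHalfPlane) : ℂ :=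
  (1 / 2) * ((2 * Real.pi * Complex.I) ^ 2)⁻¹ *
    (iteratedDeriv 2 (fun z : ℂ => theta z τ) (torsionPoint p a) / theta (torsionPoint p a) τ -
      iteratedDeriv 3 (fun z : ℂ => theta z τ) 0 / (3 * deriv (fun z : ℂ => theta z τ) 0))

/-- The character value `ξ^a`, where `ξ = e^{2πi/p}` and `a ∈ ℤ/pℤ`. -/
def xiPow (p : ℕ) (a : ZMod p) : ℂ := Complex.exp (2 * Real.pi * Complex.I / p) ^ a.val

/-- The Fricke involution `τ ↦ -1/(pτ)` of the upper half plane. -/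
def frickePoint (p : ℕ) [Fact p.Prime] (τ : UpperHalfPlane) : UpperHalfPlane :=
  UpperHalfPlane.mk (-1 / ((p : ℂ) * τ)) (by
    have hp : (0 : ℝ) < (p : ℝ)⁻¹ :=
      inv_pos.mpr (by exact_mod_cast (Fact.out : p.Prime).pos)
    have h : -1 / ((p : ℂ) * τ) = (((p : ℝ)⁻¹ : ℝ) : ℂ) * (-(τ : ℂ))⁻¹ := by
      push_cast
      rw [neg_div, one_div, mul_inv, inv_neg, mul_neg]
    rw [h, Complex.im_ofReal_mul]
    exact mul_pos hp (UpperHalfPlane.im_inv_neg_coe_pos τ))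

/-- The Fricke involution on functions of weight `n`, normalized to be an involution in each
weight and multiplicative: `(w_p f)(τ) = (√p τ / i)⁻ⁿ f(-1/(pτ))`. -/
def fricke (p : ℕ) [Fact p.Prime] (n : ℕ) (f : UpperHalfPlane → ℂ) : UpperHalfPlane → ℂ :=
  fun τ => (((Real.sqrt p : ℝ) : ℂ) * (τ : ℂ) / Complex.I) ^ (-(n : ℤ)) * f (frickePoint p τ)

/-- The polynomial ring `ℂ[s_1, …, s_{p-1}, t_1, …, t_{p-1}]`, the indices of the variables being
regarded as elements of `(ℤ/pℤ)ˣ`. -/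
abbrev STRing (p : ℕ) : Type := MvPolynomial ((ZMod p)ˣ ⊕ (ZMod p)ˣ) ℂ

/-- The variable `s_a`. -/
def sVar (p : ℕ) (a : (ZMod p)ˣ) : STRing p := MvPolynomial.X (Sum.inl a)

/-- The variable `t_a`. -/
def tVar (p : ℕ) (a : (ZMod p)ˣ) : STRing p := MvPolynomial.X (Sum.inr a)

/-- The weights of the variables: `1` for every `s_a` and `2` for every `t_a`. -/
def weight (p : ℕ) : (ZMod p)ˣ ⊕ (ZMod p)ˣ → ℕ := Sum.elim (fun _ => 1) (fun _ => 2)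

/-- Substitution of the modular forms `s_a(τ)`, `t_a(τ)` for the variables `s_a`, `t_a`. -/
def evalForms (p : ℕ) : STRing p →ₐ[ℂ] (UpperHalfPlane → ℂ) :=
  MvPolynomial.aeval (Sum.elim (sForm p) (tForm p))

/-- The ideal generated by the quadratic relations
`s_a s_b + s_b s_c + s_c s_a + t_a + t_b + t_c` for `a + b + c = 0` and by the symmetry relations
`s_{-a} = -s_a`, `t_{-a} = t_a`. -/
def relIdeal (p : ℕ) : Ideal (STRing p) :=
  Ideal.span
    ({F | ∃ a b c : (ZMod p)ˣ, (a : ZMod p) + b + c = 0 ∧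
        F = sVar p a * sVar p b + sVar p b * sVar p c + sVar p c * sVar p a
          + tVar p a + tVar p b + tVar p c} ∪
      {F | ∃ a : (ZMod p)ˣ, F = sVar p (-a) + sVar p a} ∪
      {F | ∃ a : (ZMod p)ˣ, F = tVar p (-a) - tVar p a})

/-- The ambient affine space `Spec ℂ[s, t]`. -/
abbrev affineSpace (p : ℕ) : AlgebraicGeometry.Scheme :=
  AlgebraicGeometry.Spec (CommRingCat.of (STRing p))

/-- The subscheme of `Spec ℂ[s, t]` cut out by the quadratic and the symmetry relations. -/
abbrev relScheme (p : ℕ) : AlgebraicGeometry.Scheme :=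
  AlgebraicGeometry.Spec (CommRingCat.of (STRing p ⧸ relIdeal p))

/-- The closed immersion of that subscheme. -/
def relIncl (p : ℕ) : relScheme p ⟶ affineSpace p :=
  AlgebraicGeometry.Spec.map (CommRingCat.ofHom (Ideal.Quotient.mk (relIdeal p)))

end FrickeAction

end

/-! Analytic half. Fix `τ`, put `τ' = -1/(pτ)` and `α = a/p`. The Kronecker function `θ'(0,τ') θ(α -
v/τ, τ') / (θ(α,τ') θ(-v/τ, τ'))` and the character sum `-τ ∑ ξ^{ka} (ln θ)'(v + k/p, τ)` over `k`
in `ℤ/pℤ` have the same behaviour in `v`: multiplier `ξ^{-a}` under `v ↦ v + 1/p`, period `τ`, and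
at most simple poles, with equal residues at `0`. Their difference extends to a bounded entire
function, hence is constant, and the multiplier `ξ^{-a} ≠ 1` forces it to be `0`
(`kroneckerDiff_eq_zero`). Comparing the first two Laurent coefficients after the pole at `v = 0`
gives the transformation of `s_a` and of `t_a` (`laurent_comparison_theta`). Weighted homogeneity
extends this to polynomials.

Algebraic half. The matrix `(ξ^{ka})` indexed by units is invertible and `w` is triangular in `s`
and `2t - s²`, so `w` is an automorphism. Modulo `I`, extend `s` and `t` by zero to `ℤ/pℤ`; then `w`
is a rescaled finite Fourier transform, sending `s` to the transform of `s` and `t` to that of `e =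
2t - s²`. The quadratic relation on distinct nonzero indices extends to all pairs with corrections
by `e`; transforming the extended relation kills the `t` terms and leaves exactly the corrections,
which is the quadratic relation for the images (`fourier_quad`). Summing the same relation computes
the self-convolution of `s`, from which `w² = id` modulo `I` (`fricke_fricke_s`, `fricke_fricke_t`).
This last fact also upgrades `w(I) ⊆ I` to equality. -/

open scoped BigOperators

noncomputable section

namespace FrickeAction

/-! ### The theta function: holomorphy, quasi-periods and zeros. -/

section ThetaFunction

open Complex Filter Topology

/-- The entire function `y ↦ ∏_{l ≥ 1} (1 - q^l y)`. -/
def qProd (q y : ℂ) : ℂ := ∏' l : ℕ, (1 - q ^ (l + 1) * y)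

lemma summable_norm_qProd {q : ℂ} (hq : ‖q‖ < 1) (y : ℂ) :
    Summable fun l : ℕ => ‖-(q ^ (l + 1) * y)‖ := by
  simp only [norm_neg, norm_mul, norm_pow]
  exact ((summable_nat_add_iff 1).mpr
    (summable_geometric_of_lt_one (norm_nonneg _) hq)).mul_right _

lemma multipliable_qProd {q : ℂ} (hq : ‖q‖ < 1) (y : ℂ) :
    Multipliable fun l : ℕ => 1 - q ^ (l + 1) * y := by
  simpa only [sub_eq_add_neg] using multipliable_one_add_of_summable (summable_norm_qProd hq y)

lemma differentiable_qProd {q : ℂ} (hq : ‖q‖ < 1) : Differentiable ℂ (qProd q) := by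
  intro y
  -- A geometric majorant on the ball of radius `‖y‖ + 1`, which contains `y`, makes the product
  -- converge locally uniformly there.
  have hs : Summable fun l : ℕ => ‖q‖ ^ (l + 1) * (‖y‖ + 1) :=
    ((summable_nat_add_iff 1).mpr (summable_geometric_of_lt_one (norm_nonneg _) hq)).mul_right _
  have h := hs.hasProdLocallyUniformlyOn_nat_one_add (f := fun (l : ℕ) (x : ℂ) => -(q ^ (l + 1) * x))
    (K := Metric.ball (0 : ℂ) (‖y‖ + 1)) Metric.isOpen_ball
    (.of_forall fun n x hx => by
      rw [norm_neg, norm_mul, norm_pow]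
      have : ‖x‖ < ‖y‖ + 1 := by simpa using hx
      gcongr) (fun n => by fun_prop)
  have h2 := h.differentiableOn (.of_forall fun _ => by
    simpa [Finset.prod_fn] using DifferentiableOn.finsetProd (fun _ _ => by fun_prop))
    Metric.isOpen_ball
  have h3 := h2.differentiableAt (Metric.isOpen_ball.mem_nhds (x := y) (by simp))
  simpa only [qProd, sub_eq_add_neg] using! h3

lemma qProd_eq_mul {q : ℂ} (hq : ‖q‖ < 1) (y : ℂ) :
    qProd q y = (1 - q * y) * qProd q (q * y) := by
  rw [qProd, tprod_eq_zero_mul' (by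
    convert multipliable_qProd hq (q * y) using 2; ring)]
  rw [zero_add, pow_one, qProd]
  congr 2
  ext l
  ring

lemma qProd_ne_zero {q : ℂ} (hq : ‖q‖ < 1) {y : ℂ} (h : ∀ l : ℕ, q ^ (l + 1) * y ≠ 1) :
    qProd q y ≠ 0 := by
  have := tprod_one_add_ne_zero_of_summable (f := fun l : ℕ => -(q ^ (l + 1) * y))
    (fun l => by rw [← sub_eq_add_neg, sub_ne_zero]; exact (h l).symm) (summable_norm_qProd hq y)
  simpa only [qProd, sub_eq_add_neg] using this

lemma norm_exp_two_pi_mul_lt_one {τ : ℂ} (hτ : 0 < τ.im) :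
    ‖exp (2 * Real.pi * I * τ)‖ < 1 := by
  simpa using UpperHalfPlane.norm_exp_two_pi_I_lt_one ⟨τ, hτ⟩

lemma theta_eq {τ : ℂ} (hτ : 0 < τ.im) (z : ℂ) :
    theta z τ = exp (2 * Real.pi * I * τ / 8) * (2 * sin (Real.pi * z)) *
      qProd (exp (2 * Real.pi * I * τ)) 1 *
      (qProd (exp (2 * Real.pi * I * τ)) (exp (2 * Real.pi * I * z)) *
        qProd (exp (2 * Real.pi * I * τ)) (exp (2 * Real.pi * I * z))⁻¹) := by
  have hq := norm_exp_two_pi_mul_lt_one hτ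
  simp only [theta, qProd, mul_one]
  rw [(multipliable_qProd hq _).tprod_mul (multipliable_qProd hq _)]

lemma differentiable_theta {τ : ℂ} (hτ : 0 < τ.im) : Differentiable ℂ fun z => theta z τ := by
  have hq := differentiable_qProd (norm_exp_two_pi_mul_lt_one hτ)
  simp only [theta_eq hτ]
  have h1 : Differentiable ℂ fun z : ℂ => exp (2 * Real.pi * I * z) := by fun_prop
  have h2 : Differentiable ℂ fun z : ℂ => (exp (2 * Real.pi * I * z))⁻¹ :=
    h1.inv fun z => exp_ne_zero _
  exact (Differentiable.mul (by fun_prop) (by fun_prop)).mul ((hq.comp h1).mul (hq.comp h2))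

lemma theta_neg {τ : ℂ} (hτ : 0 < τ.im) (z : ℂ) : theta (-z) τ = -theta z τ := by
  simp only [theta_eq hτ, mul_neg, sin_neg, exp_neg, inv_inv]
  ring

lemma theta_add_one {τ : ℂ} (hτ : 0 < τ.im) (z : ℂ) : theta (z + 1) τ = -theta z τ := by
  simp only [theta_eq hτ, mul_add, mul_one, sin_add_pi, exp_add, exp_two_pi_mul_I]
  ring

lemma theta_add_period {τ : ℂ} (hτ : 0 < τ.im) (z : ℂ) :
    theta (z + τ) τ = -exp (-(Real.pi * I * τ) - 2 * Real.pi * I * z) * theta z τ := by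
  have hq := norm_exp_two_pi_mul_lt_one hτ
  simp only [theta_eq hτ, mul_add, exp_add, sin]
  set q := exp (2 * Real.pi * I * τ) with hqdef
  set y := exp (2 * Real.pi * I * z) with hydef
  have hq0 : q ≠ 0 := exp_ne_zero _
  have hy0 : y ≠ 0 := exp_ne_zero _
  -- Shifting by `τ` replaces `y` by `qy`: one product loses its first factor and the other gains
  -- one. After that only a rational identity in the square roots `r`, `x` of `q`, `y` remains.
  rw [qProd_eq_mul hq y, qProd_eq_mul hq (y * q)⁻¹,
    show q * (y * q)⁻¹ = y⁻¹ by field_simp, mul_comm q y]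
  set r := exp (Real.pi * I * τ) with hr
  set x := exp (Real.pi * I * z) with hx
  have hqr : q = r ^ 2 := by rw [hqdef, hr, ← exp_nat_mul]; congr 1; push_cast; ring
  have hyx : y = x ^ 2 := by rw [hydef, hx, ← exp_nat_mul]; congr 1; push_cast; ring
  have hr0 : r ≠ 0 := exp_ne_zero _
  have hx0 : x ≠ 0 := exp_ne_zero _
  have e1 : exp (-(Real.pi * z + Real.pi * τ) * I) = x⁻¹ * r⁻¹ := by
    rw [hx, hr, ← exp_neg, ← exp_neg, ← exp_add]; congr 1; ring
  have e2 : exp ((Real.pi * z + Real.pi * τ) * I) = x * r := by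
    rw [hx, hr, ← exp_add]; congr 1; ring
  have e3 : exp (-(Real.pi * z) * I) = x⁻¹ := by
    rw [hx, ← exp_neg]; congr 1; ring
  have e4 : exp ((Real.pi * z) * I) = x := by
    rw [hx]; congr 1; ring
  have e5 : exp (-(Real.pi * I * τ) - 2 * Real.pi * I * z) = r⁻¹ * (x ^ 2)⁻¹ := by
    rw [exp_sub, exp_neg, ← hyx, div_eq_mul_inv]
  rw [e1, e2, e3, e4, e5]
  generalize qProd q (y * q) = A
  generalize qProd q y⁻¹ = B
  rw [hqr, hyx]
  field_simp
  ring

lemma theta_zero {τ : ℂ} (hτ : 0 < τ.im) : theta 0 τ = 0 := by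
  simp [theta_eq hτ]

/-- A convergent product vanishes only if a factor does: the sine gives the integers, the two
products give the points with `n < 0` and `n > 0`. -/
lemma theta_eq_zero {τ z : ℂ} (hτ : 0 < τ.im) (h : theta z τ = 0) :
    ∃ m n : ℤ, z = m + n * τ := by
  have hq := norm_exp_two_pi_mul_lt_one hτ
  have hpi : (Real.pi : ℂ) ≠ 0 := by exact_mod_cast Real.pi_ne_zero
  have hexp : ∀ w : ℂ, exp (2 * Real.pi * I * w) = 1 → ∃ m : ℤ, w = m := by
    intro w hw
    obtain ⟨m, hm⟩ := exp_eq_one_iff.mp hw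
    exact ⟨m, mul_left_cancel₀ two_pi_I_ne_zero (by rw [hm]; ring)⟩
  by_contra! hz
  refine absurd h ?_
  rw [theta_eq hτ]
  refine mul_ne_zero (mul_ne_zero (mul_ne_zero (exp_ne_zero _) (mul_ne_zero two_ne_zero ?_)) ?_)
    (mul_ne_zero ?_ ?_)
  · intro hs
    obtain ⟨k, hk⟩ := sin_eq_zero_iff.mp hs
    refine hz k 0 ?_
    rw [mul_comm] at hk
    simpa using mul_right_cancel₀ hpi hk
  · refine qProd_ne_zero hq fun l hl => ?_
    have : ‖exp (2 * Real.pi * I * τ)‖ ^ (l + 1) = 1 := by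
      rw [← norm_pow, ← mul_one (_ ^ _), hl, norm_one]
    exact absurd this (pow_lt_one₀ (norm_nonneg _) hq (Nat.succ_ne_zero l)).ne
  · refine qProd_ne_zero hq fun l hl => ?_
    rw [← exp_nat_mul, ← exp_add] at hl
    obtain ⟨m, hm⟩ := hexp ((l + 1 : ℕ) * τ + z) (by rw [← hl]; congr 1; ring)
    exact hz m (-(l + 1 : ℕ)) (by rw [← hm]; push_cast; ring)
  · refine qProd_ne_zero hq fun l hl => ?_
    rw [← exp_nat_mul, ← exp_neg, ← exp_add] at hl
    obtain ⟨m, hm⟩ := hexp ((l + 1 : ℕ) * τ - z) (by rw [← hl]; congr 1; ring)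
    exact hz (-m) (l + 1 : ℕ) (by push_cast; rw [← hm]; push_cast; ring)

/-- Only the sine vanishes at `0`, and it does so simply; the cofactor `G` is nonzero there. -/
lemma deriv_theta_zero_ne_zero {τ : ℂ} (hτ : 0 < τ.im) : deriv (fun z => theta z τ) 0 ≠ 0 := by
  have hq := norm_exp_two_pi_mul_lt_one hτ
  have hpi : (Real.pi : ℂ) ≠ 0 := by exact_mod_cast Real.pi_ne_zero
  have hQ : qProd (exp (2 * Real.pi * I * τ)) 1 ≠ 0 := by
    refine qProd_ne_zero hq fun l hl => ?_
    have : ‖exp (2 * Real.pi * I * τ)‖ ^ (l + 1) = 1 := by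
      rw [← norm_pow, ← mul_one (_ ^ _), hl, norm_one]
    exact absurd this (pow_lt_one₀ (norm_nonneg _) hq (Nat.succ_ne_zero l)).ne
  set G : ℂ → ℂ := fun z => exp (2 * Real.pi * I * τ / 8) * 2 *
      qProd (exp (2 * Real.pi * I * τ)) 1 *
      (qProd (exp (2 * Real.pi * I * τ)) (exp (2 * Real.pi * I * z)) *
        qProd (exp (2 * Real.pi * I * τ)) (exp (2 * Real.pi * I * z))⁻¹) with hG
  have hGd : DifferentiableAt ℂ G 0 := by
    have hq := differentiable_qProd (norm_exp_two_pi_mul_lt_one hτ)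
    have h1 : Differentiable ℂ fun z : ℂ => exp (2 * Real.pi * I * z) := by fun_prop
    have h2 : Differentiable ℂ fun z : ℂ => (exp (2 * Real.pi * I * z))⁻¹ :=
      h1.inv fun z => exp_ne_zero _
    exact (Differentiable.mul (by fun_prop) ((hq.comp h1).mul (hq.comp h2))) 0
  have hfac : (fun z => theta z τ) = fun z => sin (Real.pi * z) * G z := by
    ext z
    rw [theta_eq hτ]
    ring
  have hs : HasDerivAt (fun z : ℂ => sin (Real.pi * z)) Real.pi 0 := by
    have := (Complex.hasDerivAt_sin (Real.pi * 0)).comp (0 : ℂ)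
      ((hasDerivAt_id (0 : ℂ)).const_mul (Real.pi : ℂ))
    simpa [Function.comp_def] using this
  rw [hfac, (hs.fun_mul hGd.hasDerivAt).deriv]
  simp [hG, hpi, hQ]

end ThetaFunction

/-! ### Liouville's theorem for functions with unimodular multipliers. -/

section Liouville

open Complex Filter Topology

/-- Invariance of `‖D‖` carries the bound near `0` to every lattice point, so all singularities are
removable. The extension is bounded on a fundamental domain, hence everywhere. -/
lemma exists_eq_const_of_quasiperiodic (L : PeriodPair) {D : ℂ → ℂ}
    (hd : ∀ v ∉ L.lattice, DifferentiableAt ℂ D v)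
    (hper : ∀ l ∈ L.lattice, ∀ v ∉ L.lattice, ‖D (v + l)‖ = ‖D v‖)
    {C : ℝ} (hb : ∀ᶠ v in 𝓝[≠] (0 : ℂ), ‖D v‖ ≤ C) :
    ∃ c, ∀ v ∉ L.lattice, D v = c := by
  -- Limits over punctured neighbourhoods agree with `D` off the lattice and supply the removable
  -- values on it.
  set E : ℂ → ℂ := fun v => limUnder (𝓝[≠] v) D with hE
  have hED : ∀ v ∉ L.lattice, E v = D v := fun v hv =>
    ((hd v hv).continuousAt.tendsto.mono_left nhdsWithin_le_nhds).limUnder_eq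
  have hopen : IsOpen ((L.lattice : Set ℂ)ᶜ) := L.isClosed_lattice.isOpen_compl
  have hpunc : ∀ l : ℂ, ∀ᶠ v in 𝓝[≠] l, v ∉ L.lattice := by
    intro l
    rw [eventually_nhdsWithin_iff]
    filter_upwards [L.compl_lattice_sdiff_singleton_mem_nhds l] with v hv hvl hm
    exact hv ⟨hm, hvl⟩
  have hdiff : Differentiable ℂ E := by
    intro v
    by_cases hv : v ∈ L.lattice
    · have hbv : ∀ᶠ w in 𝓝[≠] v, ‖D w‖ ≤ C ∧ w ∉ L.lattice := by
        have ht : Tendsto (fun w => w - v) (𝓝[≠] v) (𝓝[≠] 0) := by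
          refine tendsto_nhdsWithin_iff.mpr ⟨?_, ?_⟩
          · have : Tendsto (fun w => w - v) (𝓝 v) (𝓝 (v - v)) :=
              (continuous_id.sub continuous_const).tendsto v
            rw [sub_self] at this
            exact this.mono_left nhdsWithin_le_nhds
          · filter_upwards [self_mem_nhdsWithin] with w hw
            simpa [sub_eq_zero] using hw
        filter_upwards [ht.eventually hb, hpunc v] with w hw hwl
        refine ⟨?_, hwl⟩
        have : w - v ∉ L.lattice := fun h => hwl (by simpa using add_mem h hv)
        rwa [← hper v hv _ this, sub_add_cancel] at hw
      rw [eventually_nhdsWithin_iff] at hbv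
      set s : Set ℂ := {w | w ∈ ({v}ᶜ : Set ℂ) → ‖D w‖ ≤ C ∧ w ∉ L.lattice} with hs
      have hsn : s ∈ 𝓝 v := hbv
      have hu := differentiableOn_update_limUnder_of_bddAbove (f := D) hsn
        (fun w hw => (hd w (hw.1 hw.2).2).differentiableWithinAt)
        ⟨C, by rintro _ ⟨w, hw, rfl⟩; exact (hw.1 hw.2).1⟩
      refine (hu.differentiableAt hsn).congr_of_eventuallyEq ?_
      filter_upwards [hsn] with w hw
      by_cases hwv : w = v
      · subst hwv; simp [hE]
      · rw [Function.update_of_ne hwv, hED w (hw hwv).2]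
    · refine (hd v hv).congr_of_eventuallyEq ?_
      filter_upwards [hopen.mem_nhds hv] with w hw using hED w hw
  obtain ⟨M, hM⟩ : ∃ M, ∀ v ∈ Metric.closedBall (0 : ℂ) (∑ i, ‖L.basis i‖), ‖E v‖ ≤ M :=
    (isCompact_closedBall _ _).exists_bound_of_continuousOn hdiff.continuous.continuousOn
  have hM1 : ∀ v ∉ L.lattice, ‖E v‖ ≤ M := by
    intro v hv
    have hfl : (ZSpan.floor L.basis v : ℂ) ∈ L.lattice := by
      rw [L.lattice_eq_span_range_basis]; exact (ZSpan.floor L.basis v).2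
    have hfr : ZSpan.fract L.basis v ∉ L.lattice := fun h => hv (by
      have := add_mem h hfl
      rwa [ZSpan.fract_apply, sub_add_cancel] at this)
    have hK := hM (ZSpan.fract L.basis v) (by simpa using ZSpan.norm_fract_le L.basis v)
    rw [hED _ hfr, ← hper _ hfl _ hfr, ZSpan.fract_apply, sub_add_cancel] at hK
    rwa [hED v hv]
  have hM2 : ∀ v, ‖E v‖ ≤ M := fun v =>
    le_of_tendsto ((hdiff.continuous.norm.tendsto v).mono_left (nhdsWithin_le_nhds (s := {v}ᶜ)))
      ((hpunc v).mono fun w hw => hM1 w hw)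
  have hbdd : Bornology.IsBounded (Set.range E) :=
    isBounded_iff_forall_norm_le.mpr ⟨M, by rintro _ ⟨v, rfl⟩; exact hM2 v⟩
  exact ⟨E 0, fun v hv => by rw [← hED v hv]; exact hdiff.apply_eq_apply_of_bounded hbdd v 0⟩

/-- A function with multipliers `ζ ≠ 1` and `1` along the periods, and with at most removable
singularities, vanishes. -/
lemma eq_zero_of_multiplier_ne_one (L : PeriodPair) {D : ℂ → ℂ} {ζ : ℂ} (hζ : ‖ζ‖ = 1)
    (hζ1 : ζ ≠ 1) (hd : ∀ v ∉ L.lattice, DifferentiableAt ℂ D v)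
    (h1 : ∀ v ∉ L.lattice, D (v + L.ω₁) = ζ * D v)
    (h2 : ∀ v ∉ L.lattice, D (v + L.ω₂) = D v)
    {C : ℝ} (hb : ∀ᶠ v in 𝓝[≠] (0 : ℂ), ‖D v‖ ≤ C) :
    ∀ v ∉ L.lattice, D v = 0 := by
  have hshift : ∀ l ∈ L.lattice, ∀ v ∉ L.lattice, v + l ∉ L.lattice := fun l hl v hv h =>
    hv (by simpa using sub_mem h hl)
  -- Both multipliers have norm `1`, so the norm is invariant under the two generators and therefore
  -- under their integer span.
  obtain ⟨c, hc⟩ := exists_eq_const_of_quasiperiodic L hd (fun l hl => by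
    rw [PeriodPair.lattice] at hl
    induction hl using Submodule.span_induction with
    | mem x hx =>
      intro v hv
      rcases hx with rfl | hx
      · rw [h1 v hv, norm_mul, hζ, one_mul]
      · rw [Set.mem_singleton_iff] at hx
        rw [hx, h2 v hv]
    | zero => intro v _; rw [add_zero]
    | add x y hx hy ihx ihy =>
      intro v hv
      rw [← add_assoc, ihy _ (hshift x hx v hv), ihx v hv]
    | smul n x hx ih =>
      have hneg : ∀ v ∉ L.lattice, ‖D (v - x)‖ = ‖D v‖ := fun v hv => by
        have := ih (v + -x) (hshift _ (neg_mem hx) v hv)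
        rw [neg_add_cancel_right] at this
        rw [sub_eq_add_neg, this]
      induction n using Int.induction_on with
      | zero => intro v _; simp
      | succ n ihn =>
        intro v hv
        rw [add_smul, one_smul, ← add_assoc,
          ih _ (hshift _ (Submodule.smul_mem _ _ hx) v hv), ihn v hv]
      | pred n ihn =>
        intro v hv
        rw [sub_smul, one_smul, ← add_sub_assoc,
          hneg _ (hshift _ (Submodule.smul_mem _ _ hx) v hv), ihn v hv]) hb
  intro v hv
  have := h1 v hv
  rw [hc v hv, hc _ (hshift _ L.ω₁_mem_lattice v hv)] at this
  rw [hc v hv]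
  have h3 : (ζ - 1) * c = 0 := by linear_combination -this
  exact (mul_eq_zero.mp h3).resolve_left (sub_ne_zero.mpr hζ1)

end Liouville

/-! ### Taylor coefficients at the origin and comparison of Laurent expansions. -/

section LaurentComparison

open Complex Filter Topology

section Taylor

lemma deriv_mul_id {H : ℂ → ℂ} (hH : AnalyticAt ℂ H 0) (c : ℂ) :
    deriv (fun z => c * z * H z) 0 = c * H 0 := by
  have h1 : HasDerivAt (fun z : ℂ => c * z) c 0 := by
    simpa using (hasDerivAt_id (0 : ℂ)).const_mul c
  simpa using (h1.fun_mul hH.differentiableAt.hasDerivAt).deriv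

lemma iteratedDeriv_succ_mul_id {H : ℂ → ℂ} (hH : AnalyticAt ℂ H 0) (c : ℂ) (n : ℕ) :
    iteratedDeriv (n + 1) (fun z => c * z * H z) 0 = (n + 1) * c * iteratedDeriv n H 0 := by
  rw [iteratedDeriv_fun_mul (by fun_prop) hH.contDiffAt]
  have h1 : ∀ i : ℕ, iteratedDeriv (i + 2) (fun z : ℂ => c * z) 0 = 0 := fun i => by
    rw [iteratedDeriv_succ', iteratedDeriv_succ']
    have : deriv (fun z : ℂ => c * z) = fun _ => c := by
      ext z; simp
    rw [this]
    simp
  have h2 : deriv (fun z : ℂ => c * z) 0 = c := by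
    simp
  rw [Finset.sum_range_succ', Finset.sum_range_succ']
  rw [Finset.sum_eq_zero fun i _ => by rw [h1]; ring]
  simp [h2]

lemma iteratedDeriv_two_mul {f g : ℂ → ℂ} (hf : AnalyticAt ℂ f 0) (hg : AnalyticAt ℂ g 0) :
    iteratedDeriv 2 (fun z => f z * g z) 0 =
      iteratedDeriv 2 f 0 * g 0 + 2 * deriv f 0 * deriv g 0 + f 0 * iteratedDeriv 2 g 0 := by
  rw [iteratedDeriv_fun_mul hf.contDiffAt hg.contDiffAt]
  simp [Finset.sum_range_succ]
  ring

lemma iteratedDeriv_two_odd {f : ℂ → ℂ} (ho : ∀ z, f (-z) = -f z) : iteratedDeriv 2 f 0 = 0 := by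
  have h := iteratedDeriv_comp_neg 2 f (0 : ℂ)
  simp only [ho, neg_zero] at h
  rw [iteratedDeriv_fun_neg] at h
  simp at h
  linear_combination (-1 / 2 : ℂ) * h

lemma mul_dslope {f : ℂ → ℂ} (h0 : f 0 = 0) (z : ℂ) : z * dslope f 0 z = f z := by
  simpa [h0] using sub_smul_dslope f 0 z

lemma differentiable_dslope {f : ℂ → ℂ} (hf : Differentiable ℂ f) :
    Differentiable ℂ (dslope f 0) :=
  differentiableOn_univ.mp ((differentiableOn_dslope univ_mem).mpr hf.differentiableOn)

lemma deriv_dslope_odd {f : ℂ → ℂ} (hf : Differentiable ℂ f) (ho : ∀ z, f (-z) = -f z)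
    (h0 : f 0 = 0) : deriv (dslope f 0) 0 = 0 := by
  have h := iteratedDeriv_succ_mul_id ((differentiable_dslope hf).analyticAt 0) 1 1
  simp only [one_mul, mul_dslope h0, Nat.reduceAdd, iteratedDeriv_one] at h
  rw [iteratedDeriv_two_odd ho] at h
  norm_num at h
  exact h

lemma iteratedDeriv_two_dslope {f : ℂ → ℂ} (hf : Differentiable ℂ f) (h0 : f 0 = 0) :
    iteratedDeriv 2 (dslope f 0) 0 = iteratedDeriv 3 f 0 / 3 := by
  have h := iteratedDeriv_succ_mul_id ((differentiable_dslope hf).analyticAt 0) 1 2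
  simp only [one_mul, mul_dslope h0, Nat.reduceAdd] at h
  rw [h]
  norm_num

lemma deriv_comp_const_mul {f : ℂ → ℂ} {c : ℂ} (hf : DifferentiableAt ℂ f 0) :
    deriv (fun z => f (c * z)) 0 = c * deriv f 0 := by
  have h1 : HasDerivAt (fun z : ℂ => c * z) c 0 := by
    simpa using (hasDerivAt_id (0 : ℂ)).const_mul c
  have h2 : HasDerivAt f (deriv f 0) (c * 0) := by simpa using hf.hasDerivAt
  simpa [mul_comm, Function.comp_def] using (h2.comp (0 : ℂ) h1).deriv

/-- Comparison of the Laurent coefficients in an identity between a Kronecker function and a sum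
of logarithmic derivatives. -/
lemma laurent_comparison {Θ θ g : ℂ → ℂ} (hΘ : Differentiable ℂ Θ) (hθ : Differentiable ℂ θ)
    (oΘ : ∀ z, Θ (-z) = -Θ z) (oθ : ∀ z, θ (-z) = -θ z) (hΘ1 : deriv Θ 0 ≠ 0)
    (hθ1 : deriv θ 0 ≠ 0) {α τ : ℂ} (hα : Θ α ≠ 0) (hτ : τ ≠ 0) (hg : AnalyticAt ℂ g 0)
    (hid : ∀ᶠ v in 𝓝[≠] (0 : ℂ), deriv Θ 0 * Θ (α - v / τ) / (Θ α * Θ (-v / τ)) =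
      -τ * (logDeriv θ v + g v)) :
    logDeriv Θ α = -τ * g 0 ∧
    iteratedDeriv 2 Θ α / Θ α - iteratedDeriv 3 Θ 0 / (3 * deriv Θ 0) =
      2 * τ ^ 2 * (iteratedDeriv 3 θ 0 / (3 * deriv θ 0) + deriv g 0) := by
  have Θ0 : Θ 0 = 0 := by simpa [self_eq_neg] using oΘ 0
  have θ0 : θ 0 = 0 := by simpa [self_eq_neg] using oθ 0
  have hU := differentiable_dslope hΘ
  have hu := differentiable_dslope hθ
  have hθd : Differentiable ℂ (deriv θ) := fun z => (hθ.analyticAt z).deriv.differentiableAt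
  -- `Θ(z) = z U(z)` and `θ(z) = z u(z)` with `U`, `u` even and nonvanishing at `0`; these quotients
  -- allow the poles to be cleared.
  set U := dslope Θ 0 with hUdef
  set u := dslope θ 0 with hudef
  have U0 : U 0 = deriv Θ 0 := dslope_same Θ 0
  have u0 : u 0 = deriv θ 0 := dslope_same θ 0
  have hlin : ∀ c : ℂ, Tendsto (fun z : ℂ => c * z) (𝓝 0) (𝓝 0) := fun c => by
    have : Tendsto (fun z : ℂ => c * z) (𝓝 0) (𝓝 (c * 0)) :=
      (continuous_const.mul continuous_id).tendsto 0
    rwa [mul_zero] at this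
  have hlin' : Tendsto (fun z : ℂ => -τ * z) (𝓝[≠] 0) (𝓝[≠] 0) := by
    refine tendsto_nhdsWithin_iff.mpr ⟨(hlin (-τ)).mono_left nhdsWithin_le_nhds, ?_⟩
    filter_upwards [self_mem_nhdsWithin] with z hz
    exact mul_ne_zero (neg_ne_zero.mpr hτ) hz
  have hUne : ∀ᶠ z in 𝓝 (0 : ℂ), U z ≠ 0 :=
    hU.continuous.continuousAt.eventually_ne (by rwa [U0])
  have hune : ∀ᶠ z in 𝓝 (0 : ℂ), u (-τ * z) ≠ 0 :=
    (hlin (-τ)).eventually (hu.continuous.continuousAt.eventually_ne (by rwa [u0]))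
  set H : ℂ → ℂ := fun z => g (-τ * z) with hHdef
  have hH : AnalyticAt ℂ H 0 := by
    have : AnalyticAt ℂ g (-τ * 0) := by simpa using hg
    exact this.comp (f := fun z => -τ * z) (by fun_prop)
  have hu' : Differentiable ℂ fun z => u (-τ * z) := hu.comp (by fun_prop)
  have hθd' : Differentiable ℂ fun z => deriv θ (-τ * z) := hθd.comp (by fun_prop)
  have hΘα : Differentiable ℂ fun z => Θ (α + z) := hΘ.comp (by fun_prop)
  have aU := hU.analyticAt 0
  have au := hu'.analyticAt 0
  have aθd := hθd'.analyticAt 0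
  have aΘα := hΘα.analyticAt 0
  have aP : AnalyticAt ℂ (fun z => Θ (α + z) * u (-τ * z)) 0 := aΘα.mul au
  have aL : AnalyticAt ℂ (fun z => -τ * z * H z) 0 := by fun_prop
  have aK : AnalyticAt ℂ (fun z => u (-τ * z) * (-τ * z * H z)) 0 := au.mul aL
  have aR : AnalyticAt ℂ (fun z => deriv θ (-τ * z) + u (-τ * z) * (-τ * z * H z)) 0 :=
    aθd.add aK
  -- The identity at `v = -τz`, multiplied by `z U(z) u(-τz)`. Both sides are now analytic at `0`,
  -- so equality on the punctured neighbourhood extends across `0`.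
  have key : (fun z => deriv Θ 0 / Θ α * (Θ (α + z) * u (-τ * z))) =ᶠ[𝓝 0]
      fun z => U z * (deriv θ (-τ * z) + u (-τ * z) * (-τ * z * H z)) := by
    refine (AnalyticAt.frequently_eq_iff_eventually_eq
      (analyticAt_const.fun_mul aP) (aU.fun_mul aR)).mp ?_
    refine Eventually.frequently ?_
    filter_upwards [hlin'.eventually hid, self_mem_nhdsWithin,
      hUne.filter_mono nhdsWithin_le_nhds, hune.filter_mono nhdsWithin_le_nhds] with z hz hz0 h1 h2
    have hz0 : z ≠ 0 := hz0
    have e1 : -τ * z / τ = -z := by field_simp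
    have e2 : -(-τ * z) / τ = z := by field_simp
    rw [e1, e2, sub_neg_eq_add, logDeriv_apply, ← mul_dslope Θ0 z,
      ← mul_dslope θ0 (-τ * z), ← hUdef, ← hudef] at hz
    have h3 : g (-τ * z) = H z := rfl
    rw [h3] at hz
    generalize u (-τ * z) = w at hz h2 ⊢
    generalize deriv θ (-τ * z) = d at hz ⊢
    generalize H z = h at hz ⊢
    field_simp at hz ⊢
    linear_combination hz
  have Ud : deriv U 0 = 0 := deriv_dslope_odd hΘ oΘ Θ0
  have ud : deriv (fun z => u (-τ * z)) 0 = 0 := by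
    rw [deriv_comp_const_mul (hu 0), hudef, deriv_dslope_odd hθ oθ θ0, mul_zero]
  have θdd : deriv (fun z => deriv θ (-τ * z)) 0 = 0 := by
    have h := iteratedDeriv_two_odd oθ
    rw [iteratedDeriv_succ', iteratedDeriv_one] at h
    rw [deriv_comp_const_mul (hθd 0), h, mul_zero]
  have Udd : iteratedDeriv 2 U 0 = iteratedDeriv 3 Θ 0 / 3 := iteratedDeriv_two_dslope hΘ Θ0
  have udd : iteratedDeriv 2 (fun z => u (-τ * z)) 0 = τ ^ 2 * (iteratedDeriv 3 θ 0 / 3) := by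
    rw [iteratedDeriv_comp_const_mul hu.contDiff]
    simp only [mul_zero]
    rw [iteratedDeriv_two_dslope hθ θ0, neg_sq]
  have θddd : iteratedDeriv 2 (fun z => deriv θ (-τ * z)) 0 = τ ^ 2 * iteratedDeriv 3 θ 0 := by
    rw [iteratedDeriv_comp_const_mul hθd.contDiff]
    simp only [mul_zero]
    rw [← iteratedDeriv_succ', neg_sq]
  have Hd : deriv H 0 = -τ * deriv g 0 := deriv_comp_const_mul hg.differentiableAt
  have H0 : H 0 = g 0 := by simp [hHdef]
  have Ld : deriv (fun z => -τ * z * H z) 0 = -τ * g 0 := by rw [deriv_mul_id hH, H0]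
  have Ldd : iteratedDeriv 2 (fun z => -τ * z * H z) 0 = 2 * τ ^ 2 * deriv g 0 := by
    rw [iteratedDeriv_succ_mul_id hH (-τ) 1, iteratedDeriv_one, Hd]
    push_cast; ring
  have Kd : deriv (fun z => u (-τ * z) * (-τ * z * H z)) 0 = deriv θ 0 * (-τ * g 0) := by
    rw [deriv_fun_mul au.differentiableAt aL.differentiableAt, ud, Ld]
    simp [u0]
  have Kdd : iteratedDeriv 2 (fun z => u (-τ * z) * (-τ * z * H z)) 0 =
      deriv θ 0 * (2 * τ ^ 2 * deriv g 0) := by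
    rw [iteratedDeriv_two_mul au aL, ud, Ldd]
    simp [u0]
  have Rd : deriv (fun z => deriv θ (-τ * z) + u (-τ * z) * (-τ * z * H z)) 0 =
      deriv θ 0 * (-τ * g 0) := by
    rw [deriv_fun_add aθd.differentiableAt aK.differentiableAt, θdd, Kd, zero_add]
  have Rdd : iteratedDeriv 2 (fun z => deriv θ (-τ * z) + u (-τ * z) * (-τ * z * H z)) 0 =
      τ ^ 2 * iteratedDeriv 3 θ 0 + deriv θ 0 * (2 * τ ^ 2 * deriv g 0) := by
    rw [iteratedDeriv_fun_add aθd.contDiffAt aK.contDiffAt, θddd, Kdd]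
  have αd : deriv (fun z => Θ (α + z)) 0 = deriv Θ α := by
    rw [deriv_comp_const_add, add_zero]
  have αdd : iteratedDeriv 2 (fun z => Θ (α + z)) 0 = iteratedDeriv 2 Θ α := by
    rw [iteratedDeriv_comp_const_add]
    simp
  -- The first derivative at `0` yields the first claim and the second derivative the second; the
  -- odd-order terms of `U`, `u` and `θ'` drop out by parity.
  have k1 := key.deriv_eq
  have k2 := key.iteratedDeriv_eq 2
  rw [deriv_const_mul _ aP.differentiableAt,
    deriv_fun_mul aΘα.differentiableAt au.differentiableAt,
    deriv_fun_mul aU.differentiableAt aR.differentiableAt, αd, ud, Ud, Rd] at k1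
  rw [iteratedDeriv_const_mul _ aP.contDiffAt, iteratedDeriv_two_mul aΘα au,
    iteratedDeriv_two_mul aU aR, αdd, ud, udd, Udd, Ud, Rdd] at k2
  simp only [mul_zero, add_zero, zero_mul, zero_add, u0, U0] at k1 k2
  constructor
  · rw [logDeriv_apply]
    field_simp at k1 ⊢
    linear_combination k1
  · field_simp at k2 ⊢
    linear_combination k2

end Taylor

end LaurentComparison

/-! ### The additive character of `ℤ/pℤ` and its orthogonality. -/

section Character

open Complex

variable {p : ℕ} [Fact p.Prime]

lemma xiPow_eq_stdAddChar (a : ZMod p) : xiPow p a = ZMod.stdAddChar a := by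
  rw [ZMod.stdAddChar_apply, ZMod.toCircle_apply, xiPow, ← exp_nat_mul]
  congr 1
  ring

lemma xiPow_add (a b : ZMod p) : xiPow p (a + b) = xiPow p a * xiPow p b := by
  simp only [xiPow_eq_stdAddChar, AddChar.map_add_eq_mul]

@[simp] lemma xiPow_zero : xiPow p 0 = 1 := by simp [xiPow]

lemma norm_xiPow (a : ZMod p) : ‖xiPow p a‖ = 1 := by
  rw [xiPow_eq_stdAddChar, ZMod.stdAddChar_apply, Circle.norm_coe]

lemma xiPow_ne_one {a : ZMod p} (ha : a ≠ 0) : xiPow p a ≠ 1 := by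
  rw [xiPow_eq_stdAddChar]
  intro h
  exact ha (ZMod.injective_stdAddChar (by rw [h, AddChar.map_zero_eq_one]))

lemma xiPow_neg_eq_exp (a : ZMod p) :
    xiPow p (-a) = exp (-(2 * Real.pi * I * (a.val / p))) := by
  have h : xiPow p (-a) * xiPow p a = 1 := by rw [← xiPow_add]; simp
  rw [eq_inv_of_mul_eq_one_left h, exp_neg, xiPow, ← exp_nat_mul]
  congr 2
  ring

lemma sum_xiPow_mul (b : ZMod p) : ∑ k : ZMod p, xiPow p (k * b) = if b = 0 then (p : ℂ) else 0 := by
  simp only [xiPow_eq_stdAddChar]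
  rw [AddChar.sum_mulShift b (ZMod.isPrimitive_stdAddChar p)]
  split_ifs <;> simp

lemma sum_zmod_eq_add_sum_units {M : Type*} [AddCommMonoid M] (f : ZMod p → M) :
    ∑ k, f k = f 0 + ∑ k : (ZMod p)ˣ, f k := by
  classical
  rw [Fintype.sum_eq_add_sum_compl 0 f]
  congr 1
  symm
  refine Finset.sum_bij (fun k _ => (k : ZMod p)) (fun k _ => by simp) (fun k _ l _ h => Units.ext h)
    (fun b hb => ?_) (fun _ _ => rfl)
  have hb : b ≠ 0 := by simpa using hb
  exact ⟨Units.mk0 b hb, Finset.mem_univ _, rfl⟩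

lemma sum_units_xiPow_mul (b : ZMod p) :
    ∑ k : (ZMod p)ˣ, xiPow p (k * b) = (if b = 0 then (p : ℂ) else 0) - 1 := by
  rw [← sum_xiPow_mul, sum_zmod_eq_add_sum_units]
  simp

end Character

/-! ### The Kronecker function as a character sum of logarithmic derivatives. -/

section KroneckerFunction

open Complex Filter Topology

section LogDeriv

lemma logDeriv_theta_add_one {τ : ℂ} (hτ : 0 < τ.im) (z : ℂ) :
    logDeriv (fun z => theta z τ) (z + 1) = logDeriv (fun z => theta z τ) z := by
  have h : deriv (fun z => theta z τ) (z + 1) = -deriv (fun z => theta z τ) z := by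
    rw [← deriv_comp_add_const, ← deriv.fun_neg]
    congr 1
    ext w
    exact theta_add_one hτ w
  rw [logDeriv_apply, logDeriv_apply, h, theta_add_one hτ, neg_div_neg_eq]

lemma logDeriv_theta_add_nat {τ : ℂ} (hτ : 0 < τ.im) (z : ℂ) (n : ℕ) :
    logDeriv (fun z => theta z τ) (z + n) = logDeriv (fun z => theta z τ) z := by
  induction n with
  | zero => simp
  | succ n ih => rw [Nat.cast_succ, ← add_assoc, logDeriv_theta_add_one hτ, ih]

lemma logDeriv_theta_add_period {τ z : ℂ} (hτ : 0 < τ.im) (hz : theta z τ ≠ 0) :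
    logDeriv (fun z => theta z τ) (z + τ) =
      logDeriv (fun z => theta z τ) z - 2 * Real.pi * I := by
  have h : deriv (fun z => theta z τ) (z + τ) =
      -exp (-(Real.pi * I * τ) - 2 * Real.pi * I * z) *
        (deriv (fun z => theta z τ) z - 2 * Real.pi * I * theta z τ) := by
    rw [← deriv_comp_add_const]
    simp only [theta_add_period hτ]
    have he : HasDerivAt (fun z : ℂ => -exp (-(Real.pi * I * τ) - 2 * Real.pi * I * z))
        (-(exp (-(Real.pi * I * τ) - 2 * Real.pi * I * z) * (-(2 * Real.pi * I)))) z := by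
      have h1 : HasDerivAt (fun z : ℂ => -(Real.pi * I * τ) - 2 * Real.pi * I * z)
          (-(2 * Real.pi * I)) z := by
        simpa using ((hasDerivAt_id z).const_mul (2 * Real.pi * I)).const_sub _
      exact h1.cexp.fun_neg
    rw [(he.fun_mul (differentiable_theta hτ z).hasDerivAt).deriv]
    ring
  have h0 : exp (-(Real.pi * I * τ) - 2 * Real.pi * I * z) ≠ 0 := exp_ne_zero _
  rw [logDeriv_apply, logDeriv_apply, h, theta_add_period hτ]
  field_simp

end LogDeriv

section Kronecker

variable {p : ℕ} [Fact p.Prime]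

lemma coe_frickePoint (τ : UpperHalfPlane) :
    ((frickePoint p τ : UpperHalfPlane) : ℂ) = -1 / ((p : ℂ) * τ) := rfl

lemma prime_cast_ne_zero : (p : ℂ) ≠ 0 := by exact_mod_cast (Fact.out : p.Prime).ne_zero

/-- The lattice spanned by `1/p` and `τ`. -/
def torsionPair (p : ℕ) [Fact p.Prime] (τ : UpperHalfPlane) : PeriodPair where
  ω₁ := 1 / p
  ω₂ := τ
  indep := by
    have hp : (p : ℝ) ≠ 0 := by exact_mod_cast (Fact.out : p.Prime).ne_zero
    rw [LinearIndependent.pair_iff]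
    intro s t h
    have e : (1 / p : ℂ) = ((1 / p : ℝ) : ℂ) := by push_cast; rfl
    have him := congrArg im h
    have hre := congrArg re h
    simp only [e, real_smul, add_im, add_re, re_ofReal_mul, im_ofReal_mul, ofReal_im, ofReal_re,
      mul_zero, zero_add, zero_im, zero_re] at him hre
    have ht : t = 0 := (mul_eq_zero.mp him).resolve_right τ.im_pos.ne'
    rw [ht, zero_mul, add_zero] at hre
    exact ⟨(mul_eq_zero.mp hre).resolve_right (one_div_ne_zero hp), ht⟩

lemma mem_torsionPair {τ : UpperHalfPlane} {v : ℂ} :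
    v ∈ (torsionPair p τ).lattice ↔ ∃ m n : ℤ, (m : ℂ) * (1 / p) + n * τ = v :=
  PeriodPair.mem_lattice

lemma theta_add_div_ne_zero {τ : UpperHalfPlane} {v : ℂ} (hv : v ∉ (torsionPair p τ).lattice)
    (k : ℕ) : theta (v + k / p) τ ≠ 0 := by
  intro h
  obtain ⟨m, n, hmn⟩ := theta_eq_zero τ.im_pos h
  refine hv (mem_torsionPair.mpr ⟨m * p - k, n, ?_⟩)
  have := prime_cast_ne_zero (p := p)
  rw [eq_sub_of_add_eq hmn]
  push_cast
  field_simp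
  ring

lemma theta_fricke_ne_zero {τ : UpperHalfPlane} {v : ℂ} (hv : v ∉ (torsionPair p τ).lattice) :
    theta (-v / τ) (frickePoint p τ) ≠ 0 := by
  intro h
  obtain ⟨m, n, hmn⟩ := theta_eq_zero (frickePoint p τ).im_pos h
  refine hv (mem_torsionPair.mpr ⟨n, -m, ?_⟩)
  have := prime_cast_ne_zero (p := p)
  have hτ := τ.ne_zero
  rw [coe_frickePoint] at hmn
  field_simp at hmn
  push_cast
  field_simp
  linear_combination hmn

lemma theta_torsionPoint_ne_zero (a : (ZMod p)ˣ) (τ : UpperHalfPlane) :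
    theta (torsionPoint p a) τ ≠ 0 := by
  intro h
  obtain ⟨m, n, hmn⟩ := theta_eq_zero τ.im_pos h
  have hp := prime_cast_ne_zero (p := p)
  have e : torsionPoint p a = (((a : ZMod p).val / p : ℝ) : ℂ) := by
    rw [torsionPoint]; push_cast; rfl
  rw [e] at hmn
  have him := congrArg im hmn
  simp only [ofReal_im, add_im, intCast_im, zero_add, mul_im, intCast_re, zero_mul, add_zero] at him
  have hn : (n : ℝ) = 0 := (mul_eq_zero.mp him.symm).resolve_right τ.im_pos.ne'
  have hn' : (n : ℂ) = 0 := by exact_mod_cast hn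
  rw [hn', zero_mul, add_zero] at hmn
  push_cast at hmn
  rw [div_eq_iff hp] at hmn
  have h1 : (((a : ZMod p).val : ℕ) : ℤ) = m * p := by exact_mod_cast hmn
  have h2 : ((((a : ZMod p).val : ℕ) : ℤ) : ZMod p) = 0 := by rw [h1]; simp
  simp at h2

variable (p) in
/-- The difference between a Kronecker function for the lattice of `-1/(pτ)` and a character sum
of logarithmic derivatives of `θ(·,τ)`. -/
def kroneckerDiff (a : (ZMod p)ˣ) (τ : UpperHalfPlane) (v : ℂ) : ℂ :=
  deriv (fun z => theta z (frickePoint p τ)) 0 *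
      theta (torsionPoint p a - v / τ) (frickePoint p τ) /
      (theta (torsionPoint p a) (frickePoint p τ) * theta (-v / τ) (frickePoint p τ)) +
    τ * ∑ k : ZMod p, xiPow p (k * a) * logDeriv (fun z => theta z τ) (v + k.val / p)

lemma differentiableAt_logDeriv_theta {τ : UpperHalfPlane} {z : ℂ} (hz : theta z τ ≠ 0) :
    DifferentiableAt ℂ (logDeriv fun z => theta z τ) z := by
  have h := differentiable_theta τ.im_pos
  exact (h.analyticAt z).deriv.differentiableAt.div (h z) hz

lemma differentiableAt_kroneckerDiff (a : (ZMod p)ˣ) {τ : UpperHalfPlane} {v : ℂ}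
    (hv : v ∉ (torsionPair p τ).lattice) : DifferentiableAt ℂ (kroneckerDiff p a τ) v := by
  have hΘ := differentiable_theta (frickePoint p τ).im_pos
  have h1 : Differentiable ℂ fun v : ℂ => theta (torsionPoint p a - v / τ) (frickePoint p τ) :=
    hΘ.comp (f := fun v : ℂ => torsionPoint p a - v / τ) (by fun_prop)
  have h2 : Differentiable ℂ fun v : ℂ => theta (-v / τ) (frickePoint p τ) :=
    hΘ.comp (f := fun v : ℂ => -v / τ) (by fun_prop)
  refine DifferentiableAt.add (DifferentiableAt.div ((h1 v).const_mul _) ((h2 v).const_mul _)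
    (mul_ne_zero (theta_torsionPoint_ne_zero a _) (theta_fricke_ne_zero hv))) ?_
  refine DifferentiableAt.const_mul (DifferentiableAt.fun_sum fun k _ => ?_) _
  refine DifferentiableAt.const_mul ?_ _
  exact (differentiableAt_logDeriv_theta (theta_add_div_ne_zero hv _)).comp v (by fun_prop)

/-- Reduction modulo `p` moves the argument by an integer, a period of the logarithmic derivative.
It is needed when the shift `k ↦ k + 1` wraps around. -/
lemma logDeriv_theta_natCast_val (τ : UpperHalfPlane) (v : ℂ) (n : ℕ) :
    logDeriv (fun z => theta z τ) (v + ((n : ZMod p).val : ℂ) / p) =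
      logDeriv (fun z => theta z τ) (v + n / p) := by
  have hp := prime_cast_ne_zero (p := p)
  rw [ZMod.val_natCast, ← logDeriv_theta_add_nat τ.im_pos _ (n / p)]
  congr 1
  have : ((n % p : ℕ) : ℂ) + p * (n / p : ℕ) = n := by exact_mod_cast Nat.mod_add_div n p
  rw [← this]
  field_simp
  ring

/-- Since `-1/(pτ) = τ'`, the shift moves both theta arguments by the quasi-period `τ'`, and the
exponential factors have quotient `e^{-2πia/p}`. In the sum the shift amounts to reindexing `k`. -/
lemma kroneckerDiff_add_one_div (a : (ZMod p)ˣ) {τ : UpperHalfPlane} {v : ℂ} :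
    kroneckerDiff p a τ (v + 1 / p) = xiPow p (-a) * kroneckerDiff p a τ v := by
  have hp := prime_cast_ne_zero (p := p)
  have hτ := τ.ne_zero
  set τ' := frickePoint p τ with hτ'
  have e1 : -(v + 1 / p) / τ = -v / τ + (τ' : ℂ) := by
    rw [coe_frickePoint]; field_simp; ring
  have e2 : torsionPoint p a - (v + 1 / p) / τ = (torsionPoint p a - v / τ) + (τ' : ℂ) := by
    rw [coe_frickePoint]; field_simp; ring
  have hs : ∑ k : ZMod p, xiPow p (k * a) *
      logDeriv (fun z => theta z τ) (v + 1 / p + k.val / p) =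
      xiPow p (-a) * ∑ k : ZMod p, xiPow p (k * a) *
        logDeriv (fun z => theta z τ) (v + k.val / p) := by
    rw [← Equiv.sum_comp (Equiv.addRight (1 : ZMod p)) fun k => xiPow p (k * a) *
        logDeriv (fun z => theta z τ) (v + k.val / p), Finset.mul_sum]
    refine Finset.sum_congr rfl fun k _ => ?_
    have hk : k + 1 = ((k.val + 1 : ℕ) : ZMod p) := by simp
    simp only [Equiv.coe_addRight]
    rw [← mul_assoc, ← xiPow_add,
      show -(a : ZMod p) + (k + 1) * a = k * a by ring, hk, logDeriv_theta_natCast_val]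
    congr 2
    push_cast
    ring
  rw [kroneckerDiff, hs, e1, e2, theta_add_period τ'.im_pos, theta_add_period τ'.im_pos,
    kroneckerDiff, ← hτ', mul_add]
  congr 1
  · have h3 : exp (-(Real.pi * I * τ') - 2 * Real.pi * I * (torsionPoint p a - v / τ)) =
        xiPow p (-a) * exp (-(Real.pi * I * τ') - 2 * Real.pi * I * (-v / τ)) := by
      rw [xiPow_neg_eq_exp, ← exp_add, torsionPoint]
      congr 1
      ring
    rw [h3]
    have h0 : exp (-(Real.pi * I * τ') - 2 * Real.pi * I * (-v / τ)) ≠ 0 := exp_ne_zero _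
    generalize exp (-(Real.pi * I * τ') - 2 * Real.pi * I * (-v / τ)) = E at h0 ⊢
    generalize theta (torsionPoint p a) τ' = A
    generalize theta (-v / τ) τ' = B
    rw [show A * (-E * B) = -E * (A * B) by ring, ← mul_div_assoc,
      ← mul_div_mul_left _ (A * B) (neg_ne_zero.mpr h0)]
    congr 1
    ring
  · ring

lemma kroneckerDiff_add_period (a : (ZMod p)ˣ) {τ : UpperHalfPlane} {v : ℂ}
    (hv : v ∉ (torsionPair p τ).lattice) :
    kroneckerDiff p a τ (v + τ) = kroneckerDiff p a τ v := by
  have hτ := τ.ne_zero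
  set τ' := frickePoint p τ with hτ'
  have e1 : -v / τ = -(v + τ) / τ + 1 := by field_simp; ring
  have e2 : torsionPoint p a - v / τ = (torsionPoint p a - (v + τ) / τ) + 1 := by
    field_simp; ring
  have hs : ∑ k : ZMod p, xiPow p (k * a) *
      logDeriv (fun z => theta z τ) (v + τ + k.val / p) =
      ∑ k : ZMod p, xiPow p (k * a) * logDeriv (fun z => theta z τ) (v + k.val / p) := by
    -- Each logarithmic derivative changes by the same constant `-2πi`, which the nontrivial
    -- character sum annihilates.
    have : ∀ k : ZMod p, xiPow p (k * a) * logDeriv (fun z => theta z τ) (v + τ + k.val / p) =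
        xiPow p (k * a) * logDeriv (fun z => theta z τ) (v + k.val / p) -
          xiPow p (k * a) * (2 * Real.pi * I) := fun k => by
      rw [add_right_comm, logDeriv_theta_add_period τ.im_pos (theta_add_div_ne_zero hv _), mul_sub]
    simp only [this]
    rw [Finset.sum_sub_distrib, ← Finset.sum_mul, sum_xiPow_mul]
    simp
  rw [kroneckerDiff, kroneckerDiff, hs, e1, e2, ← hτ', theta_add_one τ'.im_pos,
    theta_add_one τ'.im_pos, mul_neg, mul_neg, neg_div_neg_eq]

lemma kroneckerDiff_eq (a : (ZMod p)ˣ) (τ : UpperHalfPlane) (v : ℂ) :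
    kroneckerDiff p a τ v =
      deriv (fun z => theta z (frickePoint p τ)) 0 *
        theta (torsionPoint p a - v / τ) (frickePoint p τ) /
        (theta (torsionPoint p a) (frickePoint p τ) * theta (-v / τ) (frickePoint p τ)) +
      τ * (logDeriv (fun z => theta z τ) v +
        ∑ k : (ZMod p)ˣ, xiPow p (k * a) *
          logDeriv (fun z => theta z τ) (v + torsionPoint p k)) := by
  rw [kroneckerDiff, sum_zmod_eq_add_sum_units]
  simp [torsionPoint]

lemma analyticAt_charSum (a : (ZMod p)ˣ) (τ : UpperHalfPlane) :
    AnalyticAt ℂ (fun v => ∑ k : (ZMod p)ˣ, xiPow p (k * a) *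
      logDeriv (fun z => theta z τ) (v + torsionPoint p k)) 0 := by
  refine Finset.analyticAt_fun_sum _ fun k _ => analyticAt_const.fun_mul ?_
  have hθ := (differentiable_theta τ.im_pos).analyticAt (0 + torsionPoint p k)
  have : AnalyticAt ℂ (logDeriv fun z => theta z τ) (0 + torsionPoint p k) :=
    hθ.deriv.div hθ (by rw [zero_add]; exact theta_torsionPoint_ne_zero k τ)
  exact this.comp (f := fun v => v + torsionPoint p k) (by fun_prop)

/-- The theta quotient contributes the pole `-τ/v` and the term `k = 0` contributes `τ/v`. What is
left of these two is `τ B(v)/v` with `B(0) = 0`, whose limit is `τ B'(0)`. -/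
lemma tendsto_kroneckerDiff (a : (ZMod p)ˣ) (τ : UpperHalfPlane) :
    ∃ c, Tendsto (kroneckerDiff p a τ) (𝓝[≠] 0) (𝓝 c) := by
  have hτ := τ.ne_zero
  have hα := theta_torsionPoint_ne_zero a (frickePoint p τ)
  have hΘ := differentiable_theta (frickePoint p τ).im_pos
  have hθ := differentiable_theta τ.im_pos
  have hΘ1 := deriv_theta_zero_ne_zero (frickePoint p τ).im_pos
  have hθ1 := deriv_theta_zero_ne_zero τ.im_pos
  have hΘ0 := theta_zero (frickePoint p τ).im_pos
  have hθ0 := theta_zero τ.im_pos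
  have hg := (analyticAt_charSum a τ).continuousAt.tendsto.mono_left
    (nhdsWithin_le_nhds (s := {0}ᶜ))
  simp only [funext (kroneckerDiff_eq a τ)]
  generalize torsionPoint p a = α at hα ⊢
  set Θ : ℂ → ℂ := fun z => theta z (frickePoint p τ) with hΘdef
  set θ : ℂ → ℂ := fun z => theta z τ with hθdef
  have hU := differentiable_dslope hΘ
  have hu := differentiable_dslope hθ
  have hdθ : Differentiable ℂ (deriv θ) := fun z => (hθ.analyticAt z).deriv.differentiableAt
  set B : ℂ → ℂ := fun v => deriv θ v / dslope θ 0 v -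
    deriv Θ 0 * Θ (α - v / τ) / (Θ α * dslope Θ 0 (-v / τ)) with hB
  have hB0 : B 0 = 0 := by
    have h1 : dslope θ 0 0 = deriv θ 0 := dslope_same θ 0
    have h2 : dslope Θ 0 0 = deriv Θ 0 := dslope_same Θ 0
    simp only [hB, neg_zero, zero_div, sub_zero, h1, h2]
    rw [div_self hθ1, mul_comm, div_self (mul_ne_zero hα hΘ1), sub_self]
  have hBd : DifferentiableAt ℂ B 0 := by
    refine DifferentiableAt.sub ((hdθ 0).div (hu 0) (by rwa [dslope_same])) ?_
    have h1 : Differentiable ℂ fun v : ℂ => Θ (α - v / τ) :=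
      hΘ.comp (f := fun v : ℂ => α - v / τ) (by fun_prop)
    have h2 : Differentiable ℂ fun v : ℂ => dslope Θ 0 (-v / τ) :=
      hU.comp (f := fun v : ℂ => -v / τ) (by fun_prop)
    exact DifferentiableAt.div ((h1 0).const_mul _) ((h2 0).const_mul _)
      (mul_ne_zero hα (by rw [neg_zero, zero_div, dslope_same]; exact hΘ1))
  have hslope := hasDerivAt_iff_tendsto_slope.mp hBd.hasDerivAt
  refine ⟨_, Tendsto.congr' ?_ ((hslope.const_mul (τ : ℂ)).add (hg.const_mul (τ : ℂ)))⟩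
  filter_upwards [self_mem_nhdsWithin] with v hv
  have hv : v ≠ 0 := hv
  have f1 : Θ (-v / τ) = -v / τ * dslope Θ 0 (-v / τ) := (mul_dslope hΘ0 _).symm
  have f2 : θ v = v * dslope θ 0 v := (mul_dslope hθ0 _).symm
  have f3 : theta (-v / τ) (frickePoint p τ) = -v / τ * dslope Θ 0 (-v / τ) := f1
  have f4 : theta (α - v / τ) (frickePoint p τ) = Θ (α - v / τ) := rfl
  have f5 : theta α (frickePoint p τ) = Θ α := rfl
  rw [slope_def_field, hB0, sub_zero, sub_zero, mul_add, ← add_assoc]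
  congr 1
  rw [f3, f4, f5, logDeriv_apply, f2]
  simp only [hB]
  generalize dslope Θ 0 (-v / τ) = U
  generalize Θ (α - v / τ) = T
  generalize dslope θ 0 v = u
  rw [show Θ α * (-v / τ * U) = -v / τ * (Θ α * U) by ring, ← div_div (deriv θ v) v u,
    div_right_comm, mul_comm (-v / τ), ← div_div _ (Θ α * U)]
  generalize deriv Θ 0 * T / (Θ α * U) = X
  generalize deriv θ v / u = Y
  field_simp
  ring

lemma kroneckerDiff_eq_zero (a : (ZMod p)ˣ) (τ : UpperHalfPlane) {v : ℂ}
    (hv : v ∉ (torsionPair p τ).lattice) : kroneckerDiff p a τ v = 0 := by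
  obtain ⟨c, hc⟩ := tendsto_kroneckerDiff a τ
  refine eq_zero_of_multiplier_ne_one (torsionPair p τ) (ζ := xiPow p (-a)) (norm_xiPow _)
    (xiPow_ne_one (by simp)) (fun v hv => differentiableAt_kroneckerDiff a hv)
    (fun v _ => kroneckerDiff_add_one_div a) (fun v hv => kroneckerDiff_add_period a hv)
    (C := ‖c‖ + 1) ?_ v hv
  exact (hc.norm.eventually_lt_const (lt_add_one _)).mono fun v hv => hv.le

lemma eventually_notMem_lattice (L : PeriodPair) : ∀ᶠ v in 𝓝[≠] (0 : ℂ), v ∉ L.lattice := by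
  rw [eventually_nhdsWithin_iff]
  filter_upwards [L.compl_lattice_sdiff_singleton_mem_nhds 0] with v hv hvl hm
  exact hv ⟨hm, hvl⟩

lemma laurent_comparison_theta (a : (ZMod p)ˣ) (τ : UpperHalfPlane) :
    logDeriv (fun z => theta z (frickePoint p τ)) (torsionPoint p a) =
      -τ * ∑ k : (ZMod p)ˣ, xiPow p (k * a) * logDeriv (fun z => theta z τ) (torsionPoint p k) ∧
    iteratedDeriv 2 (fun z => theta z (frickePoint p τ)) (torsionPoint p a) /
        theta (torsionPoint p a) (frickePoint p τ) -
      iteratedDeriv 3 (fun z => theta z (frickePoint p τ)) 0 /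
        (3 * deriv (fun z => theta z (frickePoint p τ)) 0) =
      2 * τ ^ 2 * (iteratedDeriv 3 (fun z => theta z τ) 0 / (3 * deriv (fun z => theta z τ) 0) +
        ∑ k : (ZMod p)ˣ, xiPow p (k * a) *
          deriv (logDeriv (fun z => theta z τ)) (torsionPoint p k)) := by
  have h := laurent_comparison (differentiable_theta (frickePoint p τ).im_pos)
    (differentiable_theta τ.im_pos) (theta_neg (frickePoint p τ).im_pos) (theta_neg τ.im_pos)
    (deriv_theta_zero_ne_zero (frickePoint p τ).im_pos) (deriv_theta_zero_ne_zero τ.im_pos)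
    (theta_torsionPoint_ne_zero a (frickePoint p τ)) τ.ne_zero (analyticAt_charSum a τ) (by
      filter_upwards [eventually_notMem_lattice (torsionPair p τ)] with v hv
      have := kroneckerDiff_eq_zero a τ hv
      rw [kroneckerDiff_eq] at this
      linear_combination this)
  have hd : deriv (fun v => ∑ k : (ZMod p)ˣ, xiPow p (k * a) *
      logDeriv (fun z => theta z τ) (v + torsionPoint p k)) 0 =
      ∑ k : (ZMod p)ˣ, xiPow p (k * a) *
          deriv (logDeriv (fun z => theta z τ)) (torsionPoint p k) := by
    have hk : ∀ k : (ZMod p)ˣ, DifferentiableAt ℂ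
        (fun v => logDeriv (fun z => theta z τ) (v + torsionPoint p k)) 0 := fun k => by
      have : DifferentiableAt ℂ (logDeriv fun z => theta z τ) (0 + torsionPoint p k) :=
        differentiableAt_logDeriv_theta (by rw [zero_add]; exact theta_torsionPoint_ne_zero k τ)
      exact this.comp (0 : ℂ) (f := fun v => v + torsionPoint p k) (by fun_prop)
    rw [deriv_fun_sum fun k _ => (hk k).const_mul _]
    refine Finset.sum_congr rfl fun k _ => ?_
    rw [deriv_const_mul _ (hk k), deriv_comp_add_const, zero_add]
  rw [hd] at h
  simpa only [zero_add] using h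

lemma deriv_logDeriv_theta {τ : UpperHalfPlane} {z : ℂ} (hz : theta z τ ≠ 0) :
    deriv (logDeriv (fun z => theta z τ)) z =
      iteratedDeriv 2 (fun z => theta z τ) z / theta z τ -
        (logDeriv (fun z => theta z τ) z) ^ 2 := by
  have hθ := differentiable_theta τ.im_pos
  have h1 : DifferentiableAt ℂ (deriv fun z => theta z τ) z :=
    (hθ.analyticAt z).deriv.differentiableAt
  have : logDeriv (fun z => theta z τ) = fun w => deriv (fun z => theta z τ) w / theta w τ := by
    ext w; exact logDeriv_apply _ _
  rw [this, deriv_fun_div h1 (hθ z) hz, iteratedDeriv_succ', iteratedDeriv_one]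
  field_simp

lemma sForm_frickePoint (a : (ZMod p)ˣ) (τ : UpperHalfPlane) :
    sForm p a (frickePoint p τ) = -τ * ∑ k : (ZMod p)ˣ, xiPow p (k * a) * sForm p k τ := by
  simp only [sForm]
  rw [(laurent_comparison_theta a τ).1, Finset.mul_sum, Finset.mul_sum, Finset.mul_sum]
  exact Finset.sum_congr rfl fun k _ => by ring

lemma tForm_frickePoint (a : (ZMod p)ˣ) (τ : UpperHalfPlane) :
    tForm p a (frickePoint p τ) = (τ : ℂ) ^ 2 *
      ∑ k : (ZMod p)ˣ, xiPow p (k * a) * (-(sForm p k τ) ^ 2 + 2 * tForm p k τ) := by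
  -- This sum lets the constant `θ'''(0)/(3θ'(0))` be distributed over `k` with a minus sign, which
  -- is what completes `θ''/θ` to `t_k`.
  have hsum : ∑ k : (ZMod p)ˣ, xiPow p (k * a) = -1 := by
    rw [sum_units_xiPow_mul]; simp
  rw [tForm, (laurent_comparison_theta a τ).2]
  have hk : ∀ k : (ZMod p)ˣ, xiPow p (k * a) * (-(sForm p k τ) ^ 2 + 2 * tForm p k τ) =
      ((2 * Real.pi * I) ^ 2)⁻¹ * (xiPow p (k * a) *
          deriv (logDeriv (fun z => theta z τ)) (torsionPoint p k) - xiPow p (k * a) *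
        (iteratedDeriv 3 (fun z => theta z τ) 0 / (3 * deriv (fun z => theta z τ) 0))) := by
    intro k
    rw [deriv_logDeriv_theta (theta_torsionPoint_ne_zero k τ), sForm, tForm, mul_pow, inv_pow]
    ring
  simp only [hk]
  rw [← Finset.mul_sum, Finset.sum_sub_distrib, ← Finset.sum_mul, hsum]
  ring

end Kronecker

end KroneckerFunction

/-! ### The relations under the finite Fourier transform. -/

section RelationAlgebra

section Relations

variable {p : ℕ} [Fact p.Prime] {A : Type*} [CommRing A]

/-- The quadratic and the symmetry relations, for functions on `ℤ/pℤ` vanishing at `0`. -/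
structure SatisfiesRel (S T : ZMod p → A) : Prop where
  s_zero : S 0 = 0
  t_zero : T 0 = 0
  s_neg : ∀ k, S (-k) = -S k
  t_neg : ∀ k, T (-k) = T k
  quad : ∀ i j, i ≠ 0 → j ≠ 0 → i ≠ j →
    S i * S j + S i * S (i - j) - S j * S (i - j) = T i + T j + T (i - j)

/-- The function `2 t - s²`. -/
def eFun (S T : ZMod p → A) (k : ZMod p) : A := -(S k) ^ 2 + 2 * T k

namespace SatisfiesRel

variable {S T : ZMod p → A}

lemma e_neg (h : SatisfiesRel S T) (k : ZMod p) : eFun S T (-k) = eFun S T k := by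
  simp [eFun, h.s_neg, h.t_neg]

/-- When an index vanishes or the two coincide, the left side collapses to `S²` or `0`, and `eFun`
measures the defect. Relations without exceptional pairs can be summed against characters. -/
lemma quad_all (h : SatisfiesRel S T) (i j : ZMod p) :
    S i * S j + S i * S (i - j) - S j * S (i - j) = T i + T j + T (i - j) -
      (if i = 0 then eFun S T j else 0) - (if j = 0 then eFun S T i else 0) -
      (if i = j then eFun S T i else 0) := by
  by_cases hi : i = 0
  · subst hi
    by_cases hj : j = 0
    · subst hj; simp [h.s_zero, h.t_zero, eFun]
    · rw [if_pos rfl, if_neg hj, if_neg (Ne.symm hj), zero_sub, h.s_neg, h.t_neg, h.s_zero,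
        h.t_zero, eFun]
      ring
  · by_cases hj : j = 0
    · subst hj
      rw [if_neg hi, if_pos rfl, if_neg hi, sub_zero, h.s_zero, h.t_zero, eFun]
      ring
    · by_cases hij : i = j
      · subst hij
        rw [if_neg hi, if_pos rfl, sub_self, h.s_zero, h.t_zero, eFun]
        ring
      · rw [if_neg hi, if_neg hj, if_neg hij, h.quad i j hi hj hij]
        ring

end SatisfiesRel

variable [Algebra ℂ A]

variable (A) in
/-- The additive character `a ↦ ξ^a` with values in a `ℂ`-algebra. -/
def xiAlg (a : ZMod p) : A := algebraMap ℂ A (xiPow p a)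

lemma xiAlg_add (a b : ZMod p) : xiAlg A (a + b) = xiAlg A a * xiAlg A b := by
  simp [xiAlg, xiPow_add]

lemma sum_xiAlg_mul (b : ZMod p) :
    ∑ k : ZMod p, xiAlg A (k * b) = if b = 0 then (p : A) else 0 := by
  simp only [xiAlg]
  rw [← map_sum, sum_xiPow_mul]
  split_ifs <;> simp

/-- The finite Fourier transform. -/
def fourier (f : ZMod p → A) (x : ZMod p) : A := ∑ k, xiAlg A (k * x) * f k

lemma fourier_zero (f : ZMod p → A) : fourier f 0 = ∑ k, f k := by
  simp [fourier, xiAlg]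

lemma fourier_neg (f : ZMod p → A) (x : ZMod p) : fourier f (-x) = fourier (fun k => f (-k)) x := by
  rw [fourier, fourier, ← Equiv.sum_comp (Equiv.neg (ZMod p))]
  simp

lemma fourier_const_mul (c : A) (f : ZMod p → A) (x : ZMod p) :
    fourier (fun k => c * f k) x = c * fourier f x := by
  rw [fourier, fourier, Finset.mul_sum]
  exact Finset.sum_congr rfl fun k _ => by ring

lemma fourier_fourier (f : ZMod p → A) (x : ZMod p) : fourier (fourier f) x = p * f (-x) := by
  simp only [fourier, Finset.mul_sum]
  rw [Finset.sum_comm]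
  have h : ∀ j : ZMod p, ∑ k : ZMod p, xiAlg A (k * x) * (xiAlg A (j * k) * f j) =
      if j = -x then (p : A) * f j else 0 := fun j => by
    simp only [← mul_assoc, ← xiAlg_add]
    rw [← Finset.sum_mul]
    have := sum_xiAlg_mul (A := A) (x + j)
    rw [show (fun k : ZMod p => xiAlg A (k * x + j * k)) = fun k => xiAlg A (k * (x + j)) by
      ext k; congr 1; ring, this, ite_mul, zero_mul]
    exact if_congr (by rw [add_comm, add_eq_zero_iff_eq_neg]) rfl rfl
  simp only [h]
  simp

lemma fourier_mul_fourier (f : ZMod p → A) (x y : ZMod p) :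
    fourier f x * fourier f y =
      ∑ k : ZMod p × ZMod p, xiAlg A (k.1 * x + k.2 * y) * (f k.1 * f k.2) := by
  rw [fourier, fourier, Finset.sum_mul_sum, Fintype.sum_prod_type]
  refine Finset.sum_congr rfl fun i _ => Finset.sum_congr rfl fun j _ => ?_
  rw [xiAlg_add]
  ring

namespace SatisfiesRel

variable {S T : ZMod p → A}

lemma sum_s (h : SatisfiesRel S T) : ∑ k, S k = 0 := by
  have h1 : ∑ k, S k = -∑ k, S k := by
    rw [← Finset.sum_neg_distrib, ← Equiv.sum_comp (Equiv.neg (ZMod p))]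
    simp [h.s_neg]
  have h2 : (2 : ℂ) • ∑ k, S k = 0 := by
    rw [two_smul]; nth_rewrite 1 [h1]; simp
  exact (smul_eq_zero.mp h2).resolve_left two_ne_zero

lemma fourier_s_neg (h : SatisfiesRel S T) (x : ZMod p) :
    fourier S (-x) = -fourier S x := by
  rw [fourier_neg]
  simp [fourier, h.s_neg]

/-- Sum `quad_all` for the pair `(a, j)` over `j`; the terms linear in `S` vanish because `S` has
sum zero. -/
lemma sum_mul_sub (h : SatisfiesRel S T) {a : ZMod p} (ha : a ≠ 0) :
    ∑ j, S j * S (a - j) = -(p * T a) - 2 * ∑ k, T k + 2 * eFun S T a := by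
  have h1 : ∀ f : ZMod p → A, ∑ j, f (a - j) = ∑ j, f j := fun f =>
    Equiv.sum_comp (Equiv.subLeft a) f
  have := Finset.sum_congr (rfl : (Finset.univ : Finset (ZMod p)) = _) fun j _ => h.quad_all a j
  simp only [Finset.sum_sub_distrib, Finset.sum_add_distrib, ← Finset.mul_sum, if_neg ha,
    Finset.sum_ite_eq, Finset.sum_ite_eq', h1, h.sum_s, Finset.mem_univ, if_true] at this
  simp only [Finset.sum_const, Finset.card_univ, ZMod.card, nsmul_eq_mul] at this
  linear_combination -this

/-- The self-convolution of `S` has total `(∑ S)² = 0`. Evaluating it by `sum_mul_sub`, with the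
separate value at `a = 0`, gives three times the desired difference. -/
lemma sum_e (h : SatisfiesRel S T) : ∑ k, eFun S T k = p * ∑ k, T k := by
  have h1 : ∀ (f : ZMod p → A) (a : ZMod p), ∑ j, f (a - j) = ∑ j, f j := fun f a =>
    Equiv.sum_comp (Equiv.subLeft a) f
  have h0 : ∑ j, S j * S (0 - j) = -∑ j, (S j) ^ 2 := by
    rw [← Finset.sum_neg_distrib]
    exact Finset.sum_congr rfl fun j _ => by rw [zero_sub, h.s_neg]; ring
  have hall : ∑ a, ∑ j, S j * S (a - j) = 0 := by
    rw [Finset.sum_comm]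
    have : ∀ j, ∑ a, S j * S (a - j) = 0 := fun j => by
      have h2 : ∑ a, S (a - j) = ∑ a, S a := Equiv.sum_comp (Equiv.subRight j) S
      rw [← Finset.mul_sum, h2, h.sum_s, mul_zero]
    simp [this]
  have hE : ∑ k, eFun S T k = -∑ k, (S k) ^ 2 + 2 * ∑ k, T k := by
    simp only [eFun]
    rw [Finset.sum_add_distrib, Finset.sum_neg_distrib, Finset.mul_sum]
  have hE0 : eFun S T 0 = 0 := by simp [eFun, h.s_zero, h.t_zero]
  have hsplit : ∀ a, ∑ j, S j * S (a - j) = -(p * T a) - 2 * ∑ k, T k + 2 * eFun S T a +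
      if a = 0 then ∑ k, eFun S T k else 0 := fun a => by
    by_cases ha : a = 0
    · subst ha
      rw [h0, if_pos rfl, h.t_zero, hE0, hE]
      ring
    · rw [if_neg ha, h.sum_mul_sub ha, add_zero]
  simp only [hsplit, Finset.sum_add_distrib, Finset.sum_sub_distrib, Finset.sum_neg_distrib,
    ← Finset.mul_sum, Finset.sum_ite_eq', Finset.mem_univ, if_true, Finset.sum_const,
    Finset.card_univ, ZMod.card, nsmul_eq_mul] at hall
  have h3 : (3 : ℂ) • (∑ k, eFun S T k - p * ∑ k, T k) = 0 := by
    rw [Algebra.smul_def, map_ofNat]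
    linear_combination hall
  exact sub_eq_zero.mp ((smul_eq_zero.mp h3).resolve_left three_ne_zero)

/-- Each `T` term depends on one linear form in `(i, j)`, so summing along its fibres meets a
nontrivial character and gives `0`. The corrections live on the lines `i = 0`, `j = 0`, `i = j` and
become transforms at `y`, `x`, `x + y`. -/
lemma sum_xi_mul_quad (h : SatisfiesRel S T) {x y : ZMod p} (hx : x ≠ 0) (hy : y ≠ 0) (hxy : x + y ≠ 0) :
    ∑ k : ZMod p × ZMod p, xiAlg A (k.1 * x + k.2 * y) *
      (S k.1 * S k.2 + S k.1 * S (k.1 - k.2) - S k.2 * S (k.1 - k.2)) =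
    -(fourier (eFun S T) x + fourier (eFun S T) y + fourier (eFun S T) (x + y)) := by
  have t1 : ∀ (f : ZMod p → A) {x y : ZMod p}, y ≠ 0 →
      ∑ i, ∑ j, xiAlg A (i * x + j * y) * f i = 0 := fun f x y hy => by
    refine Finset.sum_eq_zero fun i _ => ?_
    simp only [xiAlg_add, mul_right_comm _ _ (f i)]
    rw [← Finset.mul_sum, sum_xiAlg_mul, if_neg hy, mul_zero]
  have e1 : ∑ i, ∑ j, xiAlg A (i * x + j * y) * T i = 0 := t1 T hy
  have e2 : ∑ i, ∑ j, xiAlg A (i * x + j * y) * T j = 0 := by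
    rw [Finset.sum_comm]
    simp only [add_comm (_ * x)]
    exact t1 T hx
  have e3 : ∑ i, ∑ j, xiAlg A (i * x + j * y) * T (i - j) = 0 := by
    rw [Finset.sum_comm]
    have : ∀ j, ∑ i, xiAlg A (i * x + j * y) * T (i - j) =
        ∑ i, xiAlg A (i * x + j * (x + y)) * T i := fun j => by
      rw [← Equiv.sum_comp (Equiv.addRight j) fun i => xiAlg A (i * x + j * y) * T (i - j)]
      refine Finset.sum_congr rfl fun i _ => ?_
      simp only [Equiv.coe_addRight, add_sub_cancel_right]
      congr 2
      ring
    simp only [this]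
    rw [Finset.sum_comm]
    exact t1 T hxy
  simp only [h.quad_all, Fintype.sum_prod_type, mul_sub, mul_add, Finset.sum_sub_distrib,
    Finset.sum_add_distrib, e1, e2, e3, mul_ite, mul_zero, Finset.sum_ite_eq, Finset.mem_univ,
    if_true]
  rw [Finset.sum_comm]
  simp only [Finset.sum_ite_eq', Finset.mem_univ, if_true, zero_mul, zero_add, add_zero,
    ← mul_add]
  simp only [fourier]
  ring

lemma fourier_quad (h : SatisfiesRel S T) {x y z : ZMod p} (hx : x ≠ 0) (hy : y ≠ 0) (hz : z ≠ 0) (hxyz : x + y + z = 0) :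
    fourier S x * fourier S y + fourier S y * fourier S z + fourier S z * fourier S x =
      -(fourier (eFun S T) x + fourier (eFun S T) y + fourier (eFun S T) z) := by
  have hxy : x + y = -z := eq_neg_of_add_eq_zero_left hxyz
  have hz' : z = -x - y := by linear_combination hxyz
  have h1 : fourier (eFun S T) z = fourier (eFun S T) (x + y) := by
    rw [hxy, fourier_neg]
    simp only [h.e_neg]
  -- A linear map of order three and its square `e₂`. They bring the characters of the three
  -- products to the common form `k.1 * x + k.2 * y`, using `z = -x - y`.
  let e₁ : ZMod p × ZMod p ≃ ZMod p × ZMod p :=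
    ⟨fun k => (k.2 - k.1, -k.1), fun k => (-k.2, k.1 - k.2), fun k => by simp, fun k => by simp⟩
  let e₂ : ZMod p × ZMod p ≃ ZMod p × ZMod p :=
    ⟨fun k => (-k.2, k.1 - k.2), fun k => (k.2 - k.1, -k.1), fun k => by simp, fun k => by simp⟩
  rw [h1, ← h.sum_xi_mul_quad hx hy (by rw [hxy]; exact neg_ne_zero.mpr hz),
    fourier_mul_fourier, fourier_mul_fourier, fourier_mul_fourier,
    ← Equiv.sum_comp e₁ fun k => xiAlg A (k.1 * y + k.2 * z) * (S k.1 * S k.2),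
    ← Equiv.sum_comp e₂ fun k => xiAlg A (k.1 * z + k.2 * x) * (S k.1 * S k.2),
    ← Finset.sum_add_distrib, ← Finset.sum_add_distrib]
  refine Finset.sum_congr rfl fun k _ => ?_
  have a1 : (e₁ k).1 * y + (e₁ k).2 * z = k.1 * x + k.2 * y := by
    simp only [e₁, Equiv.coe_fn_mk, hz']; ring
  have a2 : (e₂ k).1 * z + (e₂ k).2 * x = k.1 * x + k.2 * y := by
    simp only [e₂, Equiv.coe_fn_mk, hz']; ring
  have b1 : S (k.2 - k.1) = -S (k.1 - k.2) := by rw [← h.s_neg, neg_sub]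
  rw [a1, a2]
  simp only [e₁, e₂, Equiv.coe_fn_mk, h.s_neg, b1]
  ring

/-- The transform of a squared transform is `p` times the self-convolution at `-a`, which is even in
`a` because `S` is odd. -/
lemma fourier_s_sq (h : SatisfiesRel S T) {a : ZMod p} (ha : a ≠ 0) :
    fourier (fun k => (fourier S k) ^ 2) a =
      p * (-(p * T a) - 2 * ∑ k, T k + 2 * eFun S T a) := by
  rw [← h.sum_mul_sub ha, fourier]
  simp only [sq, fourier_mul_fourier, Finset.mul_sum]
  rw [Finset.sum_comm, Fintype.sum_prod_type]
  have : ∀ i j : ZMod p, ∑ k : ZMod p, xiAlg A (k * a) *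
      (xiAlg A (i * k + j * k) * (S i * S j)) = if j = -a - i then p * (S i * S j) else 0 := by
    intro i j
    simp only [← mul_assoc, ← xiAlg_add]
    simp only [mul_assoc, ← Finset.sum_mul]
    rw [show (fun k : ZMod p => xiAlg A (k * a + (i * k + j * k))) =
      fun k => xiAlg A (k * (a + i + j)) by ext k; congr 1; ring, sum_xiAlg_mul, ite_mul, zero_mul]
    exact if_congr ⟨fun hj => by linear_combination hj, fun hj => by linear_combination hj⟩ rfl rfl
  simp only [this, Finset.sum_ite_eq', Finset.mem_univ, if_true]
  rw [← Equiv.sum_comp (Equiv.neg (ZMod p))]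
  refine Finset.sum_congr rfl fun i _ => ?_
  simp only [Equiv.neg_apply]
  rw [show -a - -i = -(a - i) by ring, h.s_neg, h.s_neg]
  ring

/-- The Fricke transform of the functions `s`, `t`, applied twice, is the identity on `t`. -/
lemma fricke_fricke_t (h : SatisfiesRel S T) {d : A} (hd : d * p = -1) {a : ZMod p} (ha : a ≠ 0) :
    d * (fourier (fun k => -(d * (fourier S k) ^ 2) + 2 * (d * fourier (eFun S T) k)) a -
      (-(d * (fourier S 0) ^ 2) + 2 * (d * fourier (eFun S T) 0))) = T a := by
  have h1 : fourier (fun k => -(d * (fourier S k) ^ 2) + 2 * (d * fourier (eFun S T) k)) a =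
      -d * fourier (fun k => (fourier S k) ^ 2) a + 2 * d * fourier (fourier (eFun S T)) a := by
    rw [fourier, fourier, fourier, Finset.mul_sum, Finset.mul_sum, ← Finset.sum_add_distrib]
    exact Finset.sum_congr rfl fun k _ => by ring
  -- The two multiples of `eFun S T a` cancel, and `sum_e` cancels the multiples of `∑ T`, leaving
  -- `(d p)² T a`.
  rw [h1, h.fourier_s_sq ha, fourier_fourier, h.e_neg, fourier_zero, fourier_zero, h.sum_s, h.sum_e]
  linear_combination (T a * (d * p - 1)) * hd

lemma fricke_fricke_s (h : SatisfiesRel S T) {d : A} (hd : d * p = -1) (a : ZMod p) :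
    d * (fourier (fourier S) a - fourier S 0) = S a := by
  rw [fourier_fourier, fourier_zero, h.sum_s, h.s_neg]
  linear_combination -S a * hd

end SatisfiesRel

end Relations

end RelationAlgebra

/-! ### The Fricke transformation on polynomials, on the quotient and on forms. -/

section FrickeTransformation

section Extension

variable {p : ℕ} [Fact p.Prime] {A : Type*} [CommRing A]

/-- Extension by zero of a function on the units of `ℤ/pℤ`. -/
def extendZero (f : (ZMod p)ˣ → A) (k : ZMod p) : A :=
  if h : k = 0 then 0 else f (Units.mk0 k h)

@[simp] lemma extendZero_zero (f : (ZMod p)ˣ → A) : extendZero f 0 = 0 := by simp [extendZero]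

@[simp] lemma extendZero_coe (f : (ZMod p)ˣ → A) (k : (ZMod p)ˣ) : extendZero f k = f k := by
  simp [extendZero]

lemma satisfiesRel_extendZero {s t : (ZMod p)ˣ → A}
    (hs : ∀ a, s (-a) + s a = 0) (ht : ∀ a, t (-a) - t a = 0)
    (hq : ∀ a b c : (ZMod p)ˣ, (a : ZMod p) + b + c = 0 →
      s a * s b + s b * s c + s c * s a + t a + t b + t c = 0) :
    SatisfiesRel (extendZero s) (extendZero t) := by
  have hsn : ∀ k, extendZero s (-k) = -extendZero s k := fun k => by
    by_cases hk : k = 0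
    · simp [hk]
    · lift k to (ZMod p)ˣ using isUnit_iff_ne_zero.mpr hk
      rw [← Units.val_neg, extendZero_coe, extendZero_coe]
      exact eq_neg_of_add_eq_zero_left (hs k)
  have htn : ∀ k, extendZero t (-k) = extendZero t k := fun k => by
    by_cases hk : k = 0
    · simp [hk]
    · lift k to (ZMod p)ˣ using isUnit_iff_ne_zero.mpr hk
      rw [← Units.val_neg, extendZero_coe, extendZero_coe]
      exact sub_eq_zero.mp (ht k)
  refine ⟨extendZero_zero _, extendZero_zero _, hsn, htn, fun i j hi hj hij => ?_⟩
  -- The triple `(i, -j, j - i)` sums to zero; parity of `s` and `t` then gives the difference form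
  -- of the relation.
  have h := hq (Units.mk0 i hi) (Units.mk0 (-j) (neg_ne_zero.mpr hj))
    (Units.mk0 (-(i - j)) (neg_ne_zero.mpr (sub_ne_zero.mpr hij)))
    (by simp only [Units.val_mk0]; ring)
  simp only [← extendZero_coe s, ← extendZero_coe t, Units.val_mk0, hsn, htn] at h
  linear_combination -h

variable [Algebra ℂ A]

lemma sum_units_smul (g : ZMod p → A) (a : ZMod p) :
    ∑ k : (ZMod p)ˣ, xiPow p (k * a) • g k = fourier g a - g 0 := by
  rw [fourier, sum_zmod_eq_add_sum_units]
  simp [xiAlg, Algebra.smul_def]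

end Extension

/-! ### Inverting the character matrix on the units. -/

section Inversion

variable {p : ℕ} [Fact p.Prime]

/-- The inverse of the matrix `(ξ^{ka})`, for `k` and `a` in `(ℤ/pℤ)ˣ`. -/
def xiInv (a k : (ZMod p)ˣ) : ℂ := (p : ℂ)⁻¹ * (xiPow p (-(k * a : ZMod p)) - 1)

lemma sum_xiInv_mul (a j : (ZMod p)ˣ) :
    ∑ k : (ZMod p)ˣ, xiInv a k * xiPow p (j * k) = if j = a then 1 else 0 := by
  have hp := prime_cast_ne_zero (p := p)
  -- The `-1` in `xiInv` compensates for the missing index `0`: both unit sums fall short of a full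
  -- character sum by `1`.
  have h : ∀ k : (ZMod p)ˣ, xiInv a k * xiPow p (j * k) =
      (p : ℂ)⁻¹ * (xiPow p (k * (j - a : ZMod p)) - xiPow p (k * j)) := fun k => by
    rw [xiInv, mul_assoc, sub_mul, ← xiPow_add, one_mul, mul_comm (j : ZMod p)]
    congr 3
    ring_nf
  simp only [h]
  rw [← Finset.mul_sum, Finset.sum_sub_distrib, sum_units_xiPow_mul, sum_units_xiPow_mul]
  by_cases hj : j = a
  · simp [hj, hp]
  · have : (j : ZMod p) - a ≠ 0 := sub_ne_zero.mpr fun h => hj (Units.ext h)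
    simp [hj, this]

lemma xiInv_comm (a k : (ZMod p)ˣ) : xiInv a k = xiInv k a := by
  rw [xiInv, xiInv, mul_comm (a : ZMod p)]

variable {V : Type*} [AddCommGroup V] [Module ℂ V]

lemma sum_xiInv_smul_sum (f : (ZMod p)ˣ → V) (a : (ZMod p)ˣ) :
    ∑ k : (ZMod p)ˣ, xiInv a k • ∑ j : (ZMod p)ˣ, xiPow p (j * k) • f j = f a := by
  simp only [Finset.smul_sum, smul_smul]
  rw [Finset.sum_comm]
  simp only [← Finset.sum_smul, sum_xiInv_mul]
  simp

lemma sum_xiPow_smul_sum (f : (ZMod p)ˣ → V) (a : (ZMod p)ˣ) :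
    ∑ k : (ZMod p)ˣ, xiPow p (k * a) • ∑ j : (ZMod p)ˣ, xiInv k j • f j = f a := by
  simp only [Finset.smul_sum, smul_smul]
  rw [Finset.sum_comm]
  have : ∀ j : (ZMod p)ˣ, ∑ k : (ZMod p)ˣ, xiPow p (k * a) * xiInv k j = if a = j then 1 else 0 :=
    fun j => by
      rw [← sum_xiInv_mul]
      exact Finset.sum_congr rfl fun k _ => by
        rw [xiInv_comm, mul_comm (k : ZMod p), mul_comm]
  simp only [← Finset.sum_smul, this]
  simp

end Inversion

section Homogeneous

open MvPolynomial

lemma isWeightedHomogeneous_aeval {σ ι R : Type*} [CommSemiring R] {u : σ → ℕ} {v : ι → ℕ}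
    {f : σ → MvPolynomial ι R} (hf : ∀ i, IsWeightedHomogeneous v (f i) (u i)) {n : ℕ}
    {F : MvPolynomial σ R} (hF : IsWeightedHomogeneous u F n) :
    IsWeightedHomogeneous v (aeval f F) n := by
  induction hF using IsWeightedHomogeneous.induction_on with
  | zero => rw [map_zero]; exact isWeightedHomogeneous_zero _ _ _
  | add P Q _ _ hP hQ => rw [map_add]; exact hP.add hQ
  | monomial d r hd =>
    rw [aeval_monomial, algebraMap_eq]
    refine IsWeightedHomogeneous.C_mul ?_ r
    rw [← hd, Finsupp.weight_apply]
    exact IsWeightedHomogeneous.prod _ _ _ fun i _ => (hf i).pow (d i)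

/-- Used with `c` the inverse automorphy factor, to pass from the variables to all weighted
homogeneous polynomials. -/
lemma aeval_weightedHomogeneous {σ K : Type*} [Field K] {u : σ → ℕ} {f g : σ → K} {c : K}
    (h : ∀ i, f i = c ^ u i * g i) {n : ℕ} {F : MvPolynomial σ K}
    (hF : IsWeightedHomogeneous u F n) : aeval f F = c ^ n * aeval g F := by
  induction hF using IsWeightedHomogeneous.induction_on with
  | zero => simp
  | add P Q _ _ hP hQ => rw [map_add, map_add, hP, hQ, mul_add]
  | monomial d r hd =>
    rw [aeval_monomial, aeval_monomial, ← hd, Finsupp.weight_apply, Finsupp.sum,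
      ← Finset.prod_pow_eq_pow_sum, Finsupp.prod, Finsupp.prod, mul_left_comm,
      ← Finset.prod_mul_distrib]
    congr 1
    refine Finset.prod_congr rfl fun i _ => ?_
    rw [h, mul_pow, ← pow_mul, smul_eq_mul, mul_comm (d i)]

end Homogeneous

/-! ### The automorphism of the polynomial ring. -/

section Automorphism

open MvPolynomial

lemma sqrt_sq_cast (p : ℕ) : ((Real.sqrt p : ℝ) : ℂ) ^ 2 = p := by
  rw [← Complex.ofReal_pow, Real.sq_sqrt (Nat.cast_nonneg p), Complex.ofReal_natCast]

lemma half_smul_two_mul {p : ℕ} (x : STRing p) : (1 / 2 : ℂ) • (2 * x) = x := by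
  rw [two_mul, ← two_smul ℂ x, smul_smul]
  norm_num

variable (p : ℕ) [Fact p.Prime]

lemma cpow_neg_half : (-(p : ℂ)) ^ (-(1 / 2) : ℂ) = -Complex.I / (Real.sqrt p : ℝ) := by
  have hp0 : (0 : ℝ) < p := by exact_mod_cast (Fact.out : p.Prime).pos
  have hne : -(p : ℂ) ≠ 0 := neg_ne_zero.mpr prime_cast_ne_zero
  -- The principal argument of `-p` is `π`, which selects the root `-i/√p`.
  have hlog : Complex.log (-(p : ℂ)) = (Real.log p : ℝ) + Real.pi * Complex.I := by
    have h : -(p : ℂ) = ((-p : ℝ) : ℂ) := by push_cast; rfl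
    rw [Complex.log, h, Complex.arg_ofReal_of_neg (neg_lt_zero.mpr hp0), Complex.norm_real,
      norm_neg, Real.norm_of_nonneg hp0.le]
  have hsq : (Real.sqrt p : ℝ) = Real.exp (Real.log p / 2) := by
    rw [Real.exp_half, Real.exp_log hp0]
  rw [Complex.cpow_def_of_ne_zero hne, hlog, hsq, Complex.ofReal_exp,
    show ((Real.log p : ℝ) + Real.pi * Complex.I) * (-(1 / 2) : ℂ) =
      -(Real.pi / 2 * Complex.I) - ((Real.log p / 2 : ℝ) : ℂ) by push_cast; ring,
    Complex.exp_sub, Complex.exp_neg, Complex.exp_pi_div_two_mul_I, Complex.inv_I]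

lemma sqrt_cast_ne_zero : ((Real.sqrt p : ℝ) : ℂ) ≠ 0 := fun h =>
  prime_cast_ne_zero (p := p) (by rw [← sqrt_sq_cast, h]; simp)

lemma cpow_neg_half_sq : ((-(p : ℂ)) ^ (-(1 / 2) : ℂ)) ^ 2 = (-(p : ℂ))⁻¹ := by
  rw [cpow_neg_half, div_pow, sqrt_sq_cast, neg_sq, Complex.I_sq, inv_neg, neg_div, one_div]

lemma cpow_neg_half_ne_zero : (-(p : ℂ)) ^ (-(1 / 2) : ℂ) ≠ 0 := by
  rw [cpow_neg_half]
  exact div_ne_zero (neg_ne_zero.mpr Complex.I_ne_zero) (sqrt_cast_ne_zero p)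

lemma neg_prime_inv_ne_zero : (-(p : ℂ))⁻¹ ≠ 0 :=
  inv_ne_zero (neg_ne_zero.mpr prime_cast_ne_zero)

/-- The images of the variables under the Fricke transformation. -/
def frickeImage : (ZMod p)ˣ ⊕ (ZMod p)ˣ → STRing p :=
  Sum.elim
    (fun a => (-(p : ℂ)) ^ (-(1 / 2) : ℂ) • ∑ k : (ZMod p)ˣ, xiPow p (k * a) • sVar p k)
    (fun a => (-(p : ℂ))⁻¹ • ∑ k : (ZMod p)ˣ,
      xiPow p (k * a) • (-(sVar p k) ^ 2 + 2 * tVar p k))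

/-- The Fricke transformation of the polynomial ring. -/
def frickeHom : STRing p →ₐ[ℂ] STRing p := aeval (frickeImage p)

/-- The inverse images of the variables under the Fricke transformation. -/
def frickeInvImage : (ZMod p)ˣ ⊕ (ZMod p)ˣ → STRing p :=
  Sum.elim
    (fun a => ((-(p : ℂ)) ^ (-(1 / 2) : ℂ))⁻¹ • ∑ k : (ZMod p)ˣ, xiInv a k • sVar p k)
    (fun a => (1 / 2 : ℂ) • ((-(p : ℂ))⁻¹⁻¹ • ∑ k : (ZMod p)ˣ, xiInv a k • tVar p k +
      (((-(p : ℂ)) ^ (-(1 / 2) : ℂ))⁻¹ • ∑ k : (ZMod p)ˣ, xiInv a k • sVar p k) ^ 2))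

/-- The inverse of the Fricke transformation of the polynomial ring. -/
def frickeInvHom : STRing p →ₐ[ℂ] STRing p := aeval (frickeInvImage p)

variable {p}

lemma frickeHom_sVar (a : (ZMod p)ˣ) : frickeHom p (sVar p a) =
    (-(p : ℂ)) ^ (-(1 / 2) : ℂ) • ∑ k : (ZMod p)ˣ, xiPow p (k * a) • sVar p k := by
  simp [frickeHom, sVar, frickeImage]

lemma frickeHom_tVar (a : (ZMod p)ˣ) : frickeHom p (tVar p a) =
    (-(p : ℂ))⁻¹ • ∑ k : (ZMod p)ˣ,
      xiPow p (k * a) • (-(sVar p k) ^ 2 + 2 * tVar p k) := by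
  rw [frickeHom, tVar, aeval_X, frickeImage, Sum.elim_inr]

lemma frickeInvHom_sVar (a : (ZMod p)ˣ) : frickeInvHom p (sVar p a) =
    ((-(p : ℂ)) ^ (-(1 / 2) : ℂ))⁻¹ • ∑ k : (ZMod p)ˣ, xiInv a k • sVar p k := by
  rw [frickeInvHom, sVar, aeval_X, frickeInvImage, Sum.elim_inl]

/-- Inverting the matrix determines the preimage of `2t_a - s_a²`; adding the square of the preimage
of `s_a` and halving isolates `t_a`. -/
lemma frickeInvHom_tVar (a : (ZMod p)ˣ) : frickeInvHom p (tVar p a) =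
    (1 / 2 : ℂ) • ((-(p : ℂ))⁻¹⁻¹ • ∑ k : (ZMod p)ˣ, xiInv a k • tVar p k +
      (frickeInvHom p (sVar p a)) ^ 2) := by
  rw [frickeInvHom_sVar, frickeInvHom, tVar, aeval_X, frickeInvImage, Sum.elim_inr]

lemma frickeHom_frickeInvHom_sVar (a : (ZMod p)ˣ) :
    frickeHom p (frickeInvHom p (sVar p a)) = sVar p a := by
  rw [frickeInvHom_sVar]
  simp only [map_smul, map_sum, frickeHom_sVar]
  simp only [smul_comm _ ((-(p : ℂ)) ^ (-(1 / 2) : ℂ)), ← Finset.smul_sum, sum_xiInv_smul_sum]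
  rw [smul_smul, mul_inv_cancel₀ (cpow_neg_half_ne_zero p), one_smul]

lemma frickeHom_comp_frickeInvHom :
    (frickeHom p).comp (frickeInvHom p) = AlgHom.id ℂ (STRing p) := by
  refine algHom_ext fun i => ?_
  rcases i with a | a
  · exact frickeHom_frickeInvHom_sVar a
  · change frickeHom p (frickeInvHom p (tVar p a)) = tVar p a
    rw [frickeInvHom_tVar]
    simp only [map_smul, map_add, map_pow, map_sum, frickeHom_frickeInvHom_sVar, frickeHom_tVar]
    simp only [smul_comm _ (-(p : ℂ))⁻¹, ← Finset.smul_sum, sum_xiInv_smul_sum]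
    rw [smul_smul, mul_inv_cancel₀ (neg_prime_inv_ne_zero p), one_smul, neg_add_eq_sub,
      sub_add_cancel, half_smul_two_mul]

lemma frickeInvHom_comp_frickeHom :
    (frickeInvHom p).comp (frickeHom p) = AlgHom.id ℂ (STRing p) := by
  refine algHom_ext fun i => ?_
  rcases i with a | a
  · change frickeInvHom p (frickeHom p (sVar p a)) = sVar p a
    rw [frickeHom_sVar]
    simp only [map_smul, map_sum, frickeInvHom_sVar]
    simp only [smul_comm _ ((-(p : ℂ)) ^ (-(1 / 2) : ℂ))⁻¹, ← Finset.smul_sum, sum_xiPow_smul_sum]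
    rw [smul_smul, inv_mul_cancel₀ (cpow_neg_half_ne_zero p), one_smul]
  · change frickeInvHom p (frickeHom p (tVar p a)) = tVar p a
    rw [frickeHom_tVar]
    have h : ∀ k, frickeInvHom p (-(sVar p k) ^ 2 + 2 * tVar p k) =
        (-(p : ℂ))⁻¹⁻¹ • ∑ j : (ZMod p)ˣ, xiInv k j • tVar p j := fun k => by
      rw [map_add, map_neg, map_pow, map_mul, map_ofNat, frickeInvHom_tVar, mul_smul_comm,
        half_smul_two_mul]
      ring
    simp only [map_smul, map_sum, h]
    simp only [smul_comm _ (-(p : ℂ))⁻¹⁻¹, ← Finset.smul_sum, sum_xiPow_smul_sum]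
    rw [smul_smul, inv_mul_cancel₀ (neg_prime_inv_ne_zero p), one_smul]

variable (p) in
/-- The Fricke automorphism of the polynomial ring. -/
def frickeEquiv : STRing p ≃ₐ[ℂ] STRing p :=
  AlgEquiv.ofAlgHom (frickeHom p) (frickeInvHom p) frickeHom_comp_frickeInvHom
    frickeInvHom_comp_frickeHom

lemma isWeightedHomogeneous_frickeImage (i : (ZMod p)ˣ ⊕ (ZMod p)ˣ) :
    IsWeightedHomogeneous (weight p) (frickeImage p i) (weight p i) := by
  have hs : ∀ k, IsWeightedHomogeneous (weight p) (sVar p k) 1 := fun k =>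
    isWeightedHomogeneous_X ℂ (weight p) (Sum.inl k)
  have ht : ∀ k, IsWeightedHomogeneous (weight p) (tVar p k) 2 := fun k =>
    isWeightedHomogeneous_X ℂ (weight p) (Sum.inr k)
  rcases i with a | a
  · change IsWeightedHomogeneous (weight p) (_ • ∑ k, _) 1
    rw [smul_eq_C_mul]
    refine (IsWeightedHomogeneous.sum _ _ _ fun k _ => ?_).C_mul _
    rw [smul_eq_C_mul]
    exact (hs k).C_mul _
  · change IsWeightedHomogeneous (weight p) (_ • ∑ k, _) 2
    rw [smul_eq_C_mul]
    refine (IsWeightedHomogeneous.sum _ _ _ fun k _ => ?_).C_mul _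
    rw [smul_eq_C_mul]
    have h2 : (2 : STRing p) = C 2 := (map_ofNat C 2).symm
    rw [h2]
    exact (((hs k).pow 2).neg.add ((ht k).C_mul 2)).C_mul _

end Automorphism

/-! ### Stability of the ideal and the involution of the subscheme. -/

section Quotient

open CategoryTheory

variable {p : ℕ} [Fact p.Prime]

variable (p) in
/-- The classes of the variables `s_a` modulo the relations, extended by zero. -/
def sBar : ZMod p → STRing p ⧸ relIdeal p :=
  extendZero fun a => Ideal.Quotient.mkₐ ℂ (relIdeal p) (sVar p a)

variable (p) in
/-- The classes of the variables `t_a` modulo the relations, extended by zero. -/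
def tBar : ZMod p → STRing p ⧸ relIdeal p :=
  extendZero fun a => Ideal.Quotient.mkₐ ℂ (relIdeal p) (tVar p a)

lemma sBar_coe (a : (ZMod p)ˣ) : sBar p a = Ideal.Quotient.mkₐ ℂ (relIdeal p) (sVar p a) :=
  extendZero_coe _ a

lemma tBar_coe (a : (ZMod p)ˣ) : tBar p a = Ideal.Quotient.mkₐ ℂ (relIdeal p) (tVar p a) :=
  extendZero_coe _ a

lemma satisfiesRel_bar : SatisfiesRel (sBar p) (tBar p) := by
  refine satisfiesRel_extendZero (fun a => ?_) (fun a => ?_) fun a b c habc => ?_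
  · rw [← map_add]
    exact Ideal.Quotient.eq_zero_iff_mem.mpr (Ideal.subset_span (.inl (.inr ⟨a, rfl⟩)))
  · rw [← map_sub]
    exact Ideal.Quotient.eq_zero_iff_mem.mpr (Ideal.subset_span (.inr ⟨a, rfl⟩))
  · simp only [← map_add, ← map_mul]
    exact Ideal.Quotient.eq_zero_iff_mem.mpr (Ideal.subset_span (.inl (.inl ⟨a, b, c, habc, rfl⟩)))

lemma mk_frickeHom_sVar (a : (ZMod p)ˣ) :
    Ideal.Quotient.mkₐ ℂ (relIdeal p) (frickeHom p (sVar p a)) =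
      algebraMap ℂ _ ((-(p : ℂ)) ^ (-(1 / 2) : ℂ)) * fourier (sBar p) a := by
  have h := sum_units_smul (sBar p) (a : ZMod p)
  rw [satisfiesRel_bar.s_zero, sub_zero] at h
  rw [frickeHom_sVar, ← h, ← Algebra.smul_def]
  simp only [map_smul, map_sum, sBar_coe]

lemma mk_frickeHom_tVar (a : (ZMod p)ˣ) :
    Ideal.Quotient.mkₐ ℂ (relIdeal p) (frickeHom p (tVar p a)) =
      algebraMap ℂ _ (-(p : ℂ))⁻¹ * fourier (eFun (sBar p) (tBar p)) a := by
  have h := sum_units_smul (eFun (sBar p) (tBar p)) (a : ZMod p)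
  rw [show eFun (sBar p) (tBar p) 0 = 0 by
    simp [eFun, satisfiesRel_bar.s_zero, satisfiesRel_bar.t_zero], sub_zero] at h
  rw [frickeHom_tVar, ← h, ← Algebra.smul_def]
  simp only [map_smul, map_sum, map_add, map_neg, map_pow, map_mul, map_ofNat, eFun, sBar_coe,
    tBar_coe]

lemma algebraMap_cpow_sq {A : Type*} [CommRing A] [Algebra ℂ A] :
    (algebraMap ℂ A ((-(p : ℂ)) ^ (-(1 / 2) : ℂ))) ^ 2 = algebraMap ℂ A (-(p : ℂ))⁻¹ := by
  rw [← map_pow, cpow_neg_half_sq]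

lemma mk_frickeHom_eq_zero {F : STRing p} (hF : F ∈ relIdeal p) :
    Ideal.Quotient.mkₐ ℂ (relIdeal p) (frickeHom p F) = 0 := by
  have hle : relIdeal p ≤
      RingHom.ker ((Ideal.Quotient.mkₐ ℂ (relIdeal p)).comp (frickeHom p)) := by
    refine Ideal.span_le.mpr ?_
    rintro _ ((⟨a, b, c, habc, rfl⟩ | ⟨a, rfl⟩) | ⟨a, rfl⟩)
    all_goals
      simp only [SetLike.mem_coe, RingHom.mem_ker, AlgHom.comp_apply, map_add, map_sub, map_mul,
        mk_frickeHom_sVar, mk_frickeHom_tVar]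
    -- The products of images of `s` carry the square of `(-p)^{-1/2}`, which is the factor
    -- `(-p)^{-1}` carried by the images of `t`.
    · have h := satisfiesRel_bar.fourier_quad a.ne_zero b.ne_zero c.ne_zero habc
      have hc := algebraMap_cpow_sq (p := p) (A := STRing p ⧸ relIdeal p)
      linear_combination (algebraMap ℂ _ ((-(p : ℂ)) ^ (-(1 / 2) : ℂ))) ^ 2 * h -
        (fourier (eFun (sBar p) (tBar p)) a + fourier (eFun (sBar p) (tBar p)) b +
          fourier (eFun (sBar p) (tBar p)) c) * hc
    · rw [Units.val_neg, satisfiesRel_bar.fourier_s_neg]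
      ring
    · rw [Units.val_neg, fourier_neg]
      simp only [satisfiesRel_bar.e_neg]
      exact sub_self _
  exact hle hF

lemma mk_frickeHom_frickeHom (F : STRing p) :
    Ideal.Quotient.mkₐ ℂ (relIdeal p) (frickeHom p (frickeHom p F)) =
      Ideal.Quotient.mkₐ ℂ (relIdeal p) F := by
  set d : STRing p ⧸ relIdeal p := algebraMap ℂ _ (-(p : ℂ))⁻¹ with hd
  have hdp : d * p = -1 := by
    rw [hd, ← map_natCast (algebraMap ℂ (STRing p ⧸ relIdeal p)), ← map_mul, inv_neg, neg_mul,
      inv_mul_cancel₀ prime_cast_ne_zero, map_neg, map_one]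
  have h : ((Ideal.Quotient.mkₐ ℂ (relIdeal p)).comp (frickeHom p)).comp (frickeHom p) =
      Ideal.Quotient.mkₐ ℂ (relIdeal p) := by
    refine MvPolynomial.algHom_ext fun i => ?_
    rcases i with a | a
    · change Ideal.Quotient.mkₐ ℂ (relIdeal p) (frickeHom p (frickeHom p (sVar p a))) =
        Ideal.Quotient.mkₐ ℂ (relIdeal p) (sVar p a)
      have hs := sum_units_smul (fun k => algebraMap ℂ _ ((-(p : ℂ)) ^ (-(1 / 2) : ℂ)) *
        fourier (sBar p) k) (a : ZMod p)
      have key : Ideal.Quotient.mkₐ ℂ (relIdeal p) (frickeHom p (frickeHom p (sVar p a))) =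
          algebraMap ℂ _ ((-(p : ℂ)) ^ (-(1 / 2) : ℂ)) * (fourier (fun k =>
            algebraMap ℂ _ ((-(p : ℂ)) ^ (-(1 / 2) : ℂ)) * fourier (sBar p) k) a -
            algebraMap ℂ _ ((-(p : ℂ)) ^ (-(1 / 2) : ℂ)) * fourier (sBar p) 0) := by
        rw [← hs, frickeHom_sVar, ← Algebra.smul_def]
        simp only [map_smul, map_sum, mk_frickeHom_sVar]
      rw [key, fourier_const_mul, ← mul_sub, ← mul_assoc, ← sq, algebraMap_cpow_sq, ← hd,
        satisfiesRel_bar.fricke_fricke_s hdp, sBar_coe]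
    · change Ideal.Quotient.mkₐ ℂ (relIdeal p) (frickeHom p (frickeHom p (tVar p a))) =
        Ideal.Quotient.mkₐ ℂ (relIdeal p) (tVar p a)
      have hs := sum_units_smul (fun k => -(d * (fourier (sBar p) k) ^ 2) +
        2 * (d * fourier (eFun (sBar p) (tBar p)) k)) (a : ZMod p)
      have key : Ideal.Quotient.mkₐ ℂ (relIdeal p) (frickeHom p (frickeHom p (tVar p a))) =
          d * (fourier (fun k => -(d * (fourier (sBar p) k) ^ 2) +
            2 * (d * fourier (eFun (sBar p) (tBar p)) k)) a - (-(d * (fourier (sBar p) 0) ^ 2) +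
            2 * (d * fourier (eFun (sBar p) (tBar p)) 0))) := by
        rw [← hs, frickeHom_tVar, hd, ← Algebra.smul_def]
        simp only [map_smul, map_sum, map_add, map_neg, map_pow, map_mul, map_ofNat,
          mk_frickeHom_sVar, mk_frickeHom_tVar, mul_pow, algebraMap_cpow_sq]
      rw [key, satisfiesRel_bar.fricke_fricke_t hdp a.ne_zero, tBar_coe]
  exact DFunLike.congr_fun h F

lemma frickeHom_mem {F : STRing p} (hF : F ∈ relIdeal p) : frickeHom p F ∈ relIdeal p :=
  Ideal.Quotient.eq_zero_iff_mem.mp (mk_frickeHom_eq_zero hF)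

lemma map_frickeEquiv_relIdeal : Ideal.map (frickeEquiv p) (relIdeal p) = relIdeal p := by
  refine le_antisymm (Ideal.map_le_iff_le_comap.mpr fun F hF => frickeHom_mem hF) fun F hF => ?_
  have h1 : frickeEquiv p ((frickeEquiv p).symm F) = F := (frickeEquiv p).apply_symm_apply F
  -- For `G = w⁻¹ F`, the congruence `w² G ≡ G` modulo `I` together with `w² G = w F ∈ I` puts `G`
  -- in `I`.
  have h2 : (frickeEquiv p).symm F ∈ relIdeal p := by
    have h := mk_frickeHom_frickeHom ((frickeEquiv p).symm F)
    change Ideal.Quotient.mkₐ ℂ (relIdeal p)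
      (frickeHom p (frickeEquiv p ((frickeEquiv p).symm F))) = _ at h
    rw [h1, mk_frickeHom_eq_zero hF] at h
    exact Ideal.Quotient.eq_zero_iff_mem.mp h.symm
  rw [← h1]
  exact Ideal.mem_map_of_mem _ h2

variable (p) in
/-- The transformation of the quotient by the relations which is induced by the Fricke
transformation. -/
def frickeQuot : STRing p ⧸ relIdeal p →+* STRing p ⧸ relIdeal p :=
  Ideal.quotientMap (relIdeal p) (frickeHom p : STRing p →+* STRing p) fun _ hF => frickeHom_mem hF

lemma frickeQuot_comp_mk : (frickeQuot p).comp (Ideal.Quotient.mk (relIdeal p)) =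
    (Ideal.Quotient.mk (relIdeal p)).comp (frickeEquiv p : STRing p →+* STRing p) :=
  RingHom.ext fun _ => rfl

lemma frickeQuot_comp_frickeQuot : (frickeQuot p).comp (frickeQuot p) = RingHom.id _ :=
  Ideal.Quotient.ringHom_ext (RingHom.ext fun F => mk_frickeHom_frickeHom F)

variable (p) in
/-- The Fricke involution of the scheme cut out by the relations. -/
def frickeSchemeHom : relScheme p ⟶ relScheme p :=
  AlgebraicGeometry.Spec.map (CommRingCat.ofHom (frickeQuot p))

lemma frickeSchemeHom_comp_self : frickeSchemeHom p ≫ frickeSchemeHom p = 𝟙 (relScheme p) := by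
  rw [frickeSchemeHom, ← AlgebraicGeometry.Spec.map_comp, ← CommRingCat.ofHom_comp,
    frickeQuot_comp_frickeQuot, CommRingCat.ofHom_id, AlgebraicGeometry.Spec.map_id]

lemma frickeSchemeHom_comp_relIncl : frickeSchemeHom p ≫ relIncl p =
    relIncl p ≫ AlgebraicGeometry.Spec.map
      (CommRingCat.ofHom (frickeEquiv p : STRing p →+* STRing p)) := by
  rw [frickeSchemeHom, relIncl, ← AlgebraicGeometry.Spec.map_comp,
    ← AlgebraicGeometry.Spec.map_comp, ← CommRingCat.ofHom_comp, ← CommRingCat.ofHom_comp,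
    frickeQuot_comp_mk]

end Quotient

/-! ### Compatibility with the Fricke involution on functions. -/

section Forms

open MvPolynomial

variable {p : ℕ} [Fact p.Prime]

lemma fricke_sForm (a : (ZMod p)ˣ) (τ : UpperHalfPlane) :
    fricke p 1 (sForm p a) τ = (-(p : ℂ)) ^ (-(1 / 2) : ℂ) *
      ∑ k : (ZMod p)ˣ, xiPow p (k * a) * sForm p k τ := by
  have hτ := τ.ne_zero
  have hs := sqrt_cast_ne_zero p
  rw [fricke, sForm_frickePoint, cpow_neg_half, ← mul_assoc]
  congr 1
  simp only [Nat.cast_one, zpow_neg, zpow_one]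
  field_simp

lemma fricke_tForm (a : (ZMod p)ˣ) (τ : UpperHalfPlane) :
    fricke p 2 (tForm p a) τ = (-(p : ℂ))⁻¹ *
      ∑ k : (ZMod p)ˣ, xiPow p (k * a) * (-(sForm p k τ) ^ 2 + 2 * tForm p k τ) := by
  have hτ := τ.ne_zero
  have hp := prime_cast_ne_zero (p := p)
  rw [fricke, tForm_frickePoint, ← mul_assoc]
  congr 1
  rw [zpow_neg, zpow_natCast, div_pow, mul_pow, sqrt_sq_cast, Complex.I_sq]
  field_simp

variable (p) in
/-- The values at `τ` of the forms `s_a`, `t_a`. -/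
def formValues (τ : UpperHalfPlane) : (ZMod p)ˣ ⊕ (ZMod p)ˣ → ℂ :=
  Sum.elim (fun a => sForm p a τ) (fun a => tForm p a τ)

lemma evalForms_apply (F : STRing p) (τ : UpperHalfPlane) :
    evalForms p F τ = aeval (formValues p τ) F := by
  have h : (Pi.evalAlgHom ℂ (fun _ : UpperHalfPlane => ℂ) τ).comp (evalForms p) =
      aeval (formValues p τ) := by
    refine algHom_ext fun i => ?_
    rcases i with a | a <;> simp [evalForms, formValues]
  exact DFunLike.congr_fun h F

lemma aeval_frickeImage (τ : UpperHalfPlane) (i : (ZMod p)ˣ ⊕ (ZMod p)ˣ) :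
    aeval (formValues p τ) (frickeImage p i) =
      ((((Real.sqrt p : ℝ) : ℂ) * τ / Complex.I)⁻¹) ^ weight p i *
        formValues p (frickePoint p τ) i := by
  rcases i with a | a
  · have h := fricke_sForm a τ
    simp only [fricke, Nat.cast_one, zpow_neg, zpow_one] at h
    simp only [weight, formValues, frickeImage, Sum.elim_inl, pow_one, h, map_smul, map_sum,
      smul_eq_mul, sVar, aeval_X]
  · have h := fricke_tForm a τ
    simp only [fricke, zpow_neg, zpow_natCast] at h
    simp only [weight, formValues, frickeImage, Sum.elim_inr, inv_pow, h, map_smul, map_sum,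
      smul_eq_mul, sVar, tVar, aeval_X, map_add, map_neg, map_pow, map_mul, map_ofNat,
      Sum.elim_inl]

lemma fricke_evalForms {n : ℕ} {F : STRing p} (hF : IsWeightedHomogeneous (weight p) F n) :
    fricke p n (evalForms p F) = evalForms p (frickeHom p F) := by
  ext τ
  have h : aeval (formValues p τ) (frickeHom p F) =
      aeval (fun i => aeval (formValues p τ) (frickeImage p i)) F := by
    rw [frickeHom, ← AlgHom.comp_apply, comp_aeval]
  rw [fricke, evalForms_apply, evalForms_apply, h,
    aeval_weightedHomogeneous (aeval_frickeImage τ) hF, zpow_neg, zpow_natCast, inv_pow]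

end Forms

end FrickeTransformation

end FrickeAction

end

theorem mainTheorem8 (p : ℕ) [Fact p.Prime] (hp : Odd p) :
    ∃ w : FrickeAction.STRing p ≃ₐ[ℂ] FrickeAction.STRing p,
      -- the explicit formulas for the transformation `w` of the polynomial ring
      (∀ a : (ZMod p)ˣ, w (FrickeAction.sVar p a) =
        (-(p : ℂ)) ^ (-(1 / 2) : ℂ) •
          ∑ k : (ZMod p)ˣ, FrickeAction.xiPow p (k * a) • FrickeAction.sVar p k) ∧
      (∀ a : (ZMod p)ˣ, w (FrickeAction.tVar p a) =
        (-(p : ℂ))⁻¹ •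
          ∑ k : (ZMod p)ˣ, FrickeAction.xiPow p (k * a) •
            (-(FrickeAction.sVar p k) ^ 2 + 2 * FrickeAction.tVar p k)) ∧
      -- `w` is the Fricke involution, on the modular forms `s_a(τ)`, `t_a(τ)` ...
      (∀ (a : (ZMod p)ˣ) (τ : UpperHalfPlane),
        FrickeAction.fricke p 1 (FrickeAction.sForm p a) τ =
          (-(p : ℂ)) ^ (-(1 / 2) : ℂ) *
            ∑ k : (ZMod p)ˣ, FrickeAction.xiPow p (k * a) * FrickeAction.sForm p k τ) ∧
      (∀ (a : (ZMod p)ˣ) (τ : UpperHalfPlane),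
        FrickeAction.fricke p 2 (FrickeAction.tForm p a) τ =
          (-(p : ℂ))⁻¹ *
            ∑ k : (ZMod p)ˣ, FrickeAction.xiPow p (k * a) *
              (-(FrickeAction.sForm p k τ) ^ 2 + 2 * FrickeAction.tForm p k τ)) ∧
      -- ... and on all weighted homogeneous polynomials in them
      (∀ (n : ℕ) (F : FrickeAction.STRing p),
        MvPolynomial.IsWeightedHomogeneous (FrickeAction.weight p) F n →
          MvPolynomial.IsWeightedHomogeneous (FrickeAction.weight p) (w F) n ∧
          FrickeAction.fricke p n (FrickeAction.evalForms p F) = FrickeAction.evalForms p (w F)) ∧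
      -- `w` preserves the ideal of the relations and the subscheme which they cut out,
      -- on which it is an involution
      Ideal.map w (FrickeAction.relIdeal p) = FrickeAction.relIdeal p ∧
      ∃ e : FrickeAction.relScheme p ≅ FrickeAction.relScheme p,
        CategoryTheory.CategoryStruct.comp e.hom (FrickeAction.relIncl p) =
          CategoryTheory.CategoryStruct.comp (FrickeAction.relIncl p)
            (AlgebraicGeometry.Spec.map
              (CommRingCat.ofHom (w : FrickeAction.STRing p →+* FrickeAction.STRing p))) ∧
        CategoryTheory.CategoryStruct.comp e.hom e.hom =
          CategoryTheory.CategoryStruct.id (FrickeAction.relScheme p) := by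
  refine ⟨FrickeAction.frickeEquiv p, FrickeAction.frickeHom_sVar, FrickeAction.frickeHom_tVar,
    FrickeAction.fricke_sForm, FrickeAction.fricke_tForm, fun n F hF =>
      ⟨FrickeAction.isWeightedHomogeneous_aeval FrickeAction.isWeightedHomogeneous_frickeImage hF,
        FrickeAction.fricke_evalForms hF⟩, FrickeAction.map_frickeEquiv_relIdeal,
    -- An involution serves as its own inverse.
    ⟨FrickeAction.frickeSchemeHom p, FrickeAction.frickeSchemeHom p,
      FrickeAction.frickeSchemeHom_comp_self, FrickeAction.frickeSchemeHom_comp_self⟩,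
    FrickeAction.frickeSchemeHom_comp_relIncl, FrickeAction.frickeSchemeHom_comp_self⟩
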